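/- Let $d\ge 1$, write $\xi=(\xi_1,\xi')\in\mathbb R\times\mathbb R^{d-1}$, and call a subset of $\mathbb R^m\setminus 0$ conic if it is invariant under multiplication by all nonzero real numbers. Let $A_1,\dots,A_d$ be complex $k\times k$ matrices, $A(\xi)=\sum_j\xi_jA_j$, such that $\partial_t+\sum_jA_j\partial_{x_j}$ is strongly hyperbolic: $\sup_{\xi\in\mathbb R^d}\|e^{iA(\xi)}\|<\infty$. Let $\mathrm{Char}=\{(\tau,\xi)\in\mathbb R^{1+d}\setminus 0:\det(\tau I+A(\xi))=0\}$. Assume that the conormal variety $\{(\tau,\xi)\neq0:\tau=0,\ \xi'=0\}$ is contained in $\mathrm{Char}$, and that on an open conic neighborhood $W$ of it $\mathrm{Char}$ is the graph of a function $\tau$: $\mathrm{Char}\cap W=\{(\tau(\xi),\xi):\xi\in\mathcal N\}$, with $\mathcal N\subset\mathbb R^d\setminus0$ open and conic and $\tau:\mathcal N\to\mathbb R$ real analytic. Put $\lambda:=-\tau$, which is homogeneous of degree one on $\mathcal N$, and $$\mathbf v:=\nabla_\xi\lambda(1,0,\dots,0),\qquad Q(\xi',\xi'):=\frac12\sum_{2\le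 i,j\le d}\frac{\partial^2\lambda(1,0,\dots,0)}{\partial\xi_i\,\partial\xi_j}\,\xi_i\xi_j .$$ Assume that either $\mathrm{rank}\,\lambda_{\xi\xi}(1,0,\dots,0)=d-1$ or $\lambda_{\xi\xi}=0$ identically on $\mathcal N$. Let $(\underline t,\underline x)\in\mathbb R^{1+d}\setminus0$ and $\underline\xi\neq0$ with $\underline\xi'=0$ be stationary, i.e. $\underline x+\underline t\,\nabla_\xi\lambda(\underline\xi)=0$. Then there are an open conic neighborhood $\mathcal G\subset\mathcal N$ of $\underline\xi$ in $\mathbb R^d\setminus 0$, an open conic neighborhood $\mathcal M$ of $(\underline t,\underline x)$ in $\mathbb R^{1+d}\setminus 0$, and $\mu>0$ with the following property. Let $\phi\in C^\infty(\mathbb R)$ be real valued and even, with $\phi(\xi_1)=1$ for $|\xi_1|>2$ and $\phi(\xi_1)=0$ for $|\xi_1|\le1$. Let $a\in\mathcal S(\mathbb R^{d-1})$. Let $\beta\in C^\infty(\mathbb R^d\setminus0)$ satisfy $\beta(\sigma\xi)=\beta(\xi)$ for all real $\sigma\ne0$, with support in $\mathbb R^d\setminus0$ contained in $\mathcal G$.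 Then the limits $$u(t,x)=P.V.\!\int\frac{\beta(\xi)\phi(\xi_1)a(\xi')}{\xi_1}\,e^{i(x\xi+t\lambda(\xi))}\,d\xi,\qquad u_{par}(t,x)=P.V.\!\int\frac{\beta(\xi)\phi(\xi_1)a(\xi')}{\xi_1}\,e^{i(x\xi+t(\mathbf v\cdot\xi+Q(\xi',\xi')/\xi_1))}\,d\xi$$ exist for every $(t,x)\in\mathcal M$, where $P.V.\int:=\lim_{R\to\infty}\int_{|\xi_1|\le R}$ and the integrals over $\{|\xi_1|\le R\}$ converge absolutely. Moreover, $$\sup_{(t,x)\in\mathcal M}|u(t,x)|<\infty,\qquad \sup_{(t,x)\in\mathcal M}|t|^{\mu}\,|u(t,x)-u_{par}(t,x)|<\infty .$$ -/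

import Mathlib

open Filter Topology MeasureTheory
open scoped ContDiff SchwartzMap

noncomputable section

namespace PlanarJump

/-- Frequency space (and position space) `ℝ^d`, `d = n + 1`.  The coordinate `0` is the
distinguished first one; the remaining `n = d - 1` coordinates are the "primed" ones. -/
abbrev Space (n : ℕ) : Type := EuclideanSpace ℝ (Fin (n + 1))

/-- `Hom(ℂ^k)`. -/
abbrev Hom (k : ℕ) : Type := Matrix (Fin k) (Fin k) ℂ

/-- The vector `(1, 0, …, 0)`. -/
def e₁ (n : ℕ) : Space n := EuclideanSpace.single 0 1

/-- The projection `ξ = (ξ₁, ξ') ↦ ξ'`. -/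
def prime {n : ℕ} (ξ : Space n) : EuclideanSpace ℝ (Fin n) :=
  WithLp.toLp 2 fun j => ξ j.succ

/-- Open conic subsets of `V ∖ 0`; conic means invariant under all nonzero real dilations, so
such sets are centro-symmetric. -/
structure IsOpenCone {V : Type*} [AddCommGroup V] [Module ℝ V] [TopologicalSpace V]
    (S : Set V) : Prop where
  isOpen : IsOpen S
  zero_notMem : (0 : V) ∉ S
  smul_mem : ∀ σ : ℝ, σ ≠ 0 → ∀ v ∈ S, σ • v ∈ S

/-- The symbol `A(ξ) = ∑ ξ_j A_j`. -/
def symbol {n k : ℕ} (A : Fin (n + 1) → Hom k) (ξ : Space n) : Hom k :=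
  ∑ j, (ξ j : ℂ) • A j

open scoped Matrix.Norms.L2Operator in
/-- Strong hyperbolicity of `∂_t + ∑ A_j ∂_j`: `sup_ξ ‖exp(i A(ξ))‖ < ∞`, in the
operator norm on `ℂ^k`. -/
def IsStronglyHyperbolic {n k : ℕ} (A : Fin (n + 1) → Hom k) : Prop :=
  BddAbove (Set.range fun ξ : Space n => ‖NormedSpace.exp (Complex.I • symbol A ξ)‖)

/-- The characteristic variety `{(τ, ξ) ≠ 0 : det (τ I + A(ξ)) = 0}` of `∂_t + ∑ A_j ∂_j`. -/
def charVariety {n k : ℕ} (A : Fin (n + 1) → Hom k) : Set (ℝ × Space n) :=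
  {p | p ≠ 0 ∧ ((p.1 : ℂ) • (1 : Hom k) + symbol A p.2).det = 0}

/-- The conormal variety `{(τ, ξ) ≠ 0 : τ = 0, ξ' = 0}` of the hyperplane `x₁ = 0`. -/
def conormalVariety (n : ℕ) : Set (ℝ × Space n) :=
  {p | p ≠ 0 ∧ p.1 = 0 ∧ prime p.2 = 0}

/-- The hyperplane `x₁ = 0` is characteristic and its conormal variety satisfies the smooth
variety hypothesis: in the conic neighborhood `W` of the conormal variety, the characteristic
variety is the graph of `τ`, which is real analytic on the open set `N` of frequencies. -/
structure IsSmoothSheet {n k : ℕ} (A : Fin (n + 1) → Hom k) (W : Set (ℝ × Space n))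
    (N : Set (Space n)) (τ : Space n → ℝ) : Prop where
  conormal_subset_char : conormalVariety n ⊆ charVariety A
  isOpenCone_W : IsOpenCone W
  conormal_subset : conormalVariety n ⊆ W
  isOpenCone_N : IsOpenCone N
  analytic : AnalyticOnNhd ℝ τ N
  char_eq_graph : charVariety A ∩ W = {p | p.2 ∈ N ∧ p.1 = τ p.2}

/-- The matrix of second partial derivatives of `f` at `ξ`. -/
def hessian {m : ℕ} (f : EuclideanSpace ℝ (Fin m) → ℝ) (ξ : EuclideanSpace ℝ (Fin m)) :
    Matrix (Fin m) (Fin m) ℝ :=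
  Matrix.of fun i j =>
    fderiv ℝ (fun η => fderiv ℝ f η (EuclideanSpace.single j 1)) ξ (EuclideanSpace.single i 1)

/-- `v = ∇_ξ lam (1, 0, …, 0)`. -/
def groupVelocity {n : ℕ} (lam : Space n → ℝ) : Space n :=
  gradient lam (e₁ n)

/-- The quadratic form
`Q(η, η) = (1/2) ∑_{i,j ≥ 2} (∂² lam / ∂ξ_i ∂ξ_j)(1, 0, …, 0) η_i η_j` on `ℝ^{d-1}`. -/
def Q {n : ℕ} (lam : Space n → ℝ) (η : EuclideanSpace ℝ (Fin n)) : ℝ :=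
  (1 / 2) * ∑ i, ∑ j, hessian lam (e₁ n) i.succ j.succ * η i * η j

/-- The paraxial approximation `v · ξ + Q(ξ', ξ') / ξ₁` of `lam`. -/
def paraxial {n : ℕ} (lam : Space n → ℝ) (ξ : Space n) : ℝ :=
  inner ℝ (groupVelocity lam) ξ + Q lam (prime ξ) / ξ 0

/-- A point `(t, x, ξ)` with `ξ ≠ 0`, `ξ' = 0` is stationary when the `ξ`-gradient
`x + t ∇ lam(ξ)` of the phase `x · ξ + t lam(ξ)` vanishes. -/
structure IsStationary {n : ℕ} (lam : Space n → ℝ) (t : ℝ) (x ξ : Space n) : Prop where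
  ne_zero : ξ ≠ 0
  prime_eq_zero : prime ξ = 0
  gradient_eq_zero : x + t • gradient lam ξ = 0

/-- The low frequency cutoffs: smooth, even, `1` for `|s| > 2`, and `0` for `|s| ≤ 1`. -/
structure IsCutoff (φ : ℝ → ℝ) : Prop where
  smooth : ContDiff ℝ ∞ φ
  even : ∀ s, φ (-s) = φ s
  eq_one : ∀ s, 2 < |s| → φ s = 1
  eq_zero : ∀ s, |s| ≤ 1 → φ s = 0

/-- Microlocal cutoffs: smooth on `ℝ^d ∖ 0`, homogeneous of degree zero, with support in
`ℝ^d ∖ 0` contained in `G`.  The value at the origin is irrelevant. -/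
structure IsConicCutoff {n : ℕ} (G : Set (Space n)) (β : Space n → ℂ) : Prop where
  smooth : ContDiffOn ℝ ∞ β {0}ᶜ
  homogeneous : ∀ σ : ℝ, σ ≠ 0 → ∀ ξ, β (σ • ξ) = β ξ
  support_subset : tsupport β \ {0} ⊆ G

/-- The integrand `β(ξ) φ(ξ₁) a(ξ') / ξ₁ · exp(i (x · ξ + t Λ(ξ)))`. -/
def integrand {n : ℕ} (β : Space n → ℂ) (φ : ℝ → ℝ) (a : 𝓢(EuclideanSpace ℝ (Fin n), ℂ))
    (Λ : Space n → ℝ) (t : ℝ) (x ξ : Space n) : ℂ :=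
  β ξ * (φ (ξ 0) : ℂ) * a (prime ξ) / (ξ 0 : ℂ) *
    Complex.exp (Complex.I * ((inner ℝ x ξ + t * Λ ξ : ℝ) : ℂ))

/-- `P.V. ∫ F dξ = u`: the function is integrable on each slab `|ξ₁| ≤ R`, and the integrals over
these slabs converge to `u` as `R → ∞`. -/
def HasPVIntegral {n : ℕ} (F : Space n → ℂ) (u : ℂ) : Prop :=
  (∀ R : ℝ, IntegrableOn F {ξ | |ξ 0| ≤ R}) ∧
    Tendsto (fun R : ℝ => ∫ ξ in {ξ : Space n | |ξ 0| ≤ R}, F ξ) atTop (𝓝 u)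

end PlanarJump

end

/-! Near the axis `ξ' = 0` write `ξ = (r, η)`. Homogeneity gives `lam ξ = v · ξ + r q(η / r)`, where
`q` is `chartPhase lam`; Euler's identity makes `q` vanish to second order at `0`, with quadratic
part `Q lam`. The paraxial phase has the same form with `q` replaced by `Q lam`, so one analysis
serves both integrals.

With `s = (x + t v)₁` and `y = (x + t v)'`, Fubini turns each principal value into the
one-dimensional integral of `φ(r) H(r) e^{isr} / r`, where `H(r)` (`sliceIntegral`) is the integral
over `η` of `b(η / r) a(η) e^{i(y · η + t r q(η / r))}`. Two regimes control `H`. For large `|r| /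
|t|` the phase `t r q(η / r) = O(|t| |η|² / |r|)` is negligible, and `H` differs from a constant `J`
by `O((1 + |t|) / |r|)` (`exists_norm_sliceIntegral_sub_le`,
`exists_norm_sliceIntegral_zero_sub_le`). For `1 ≤ |r| ≤ |t|`, van der Corput's estimate in a single
direction `w` where the Hessian does not vanish gives `H = O(√(|r| / |t|))`
(`exists_norm_sliceIntegral_le_sqrt`). Both errors are integrable against `dr / |r|`, with a bound
independent of scale. What remains is `J` times a truncated integral of `e^{isr} / r`, which
converges boundedly because the sine integral does (`exists_tendsto_integral_mul_exp_div`). All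
constants are uniform in `t`, `y` and `s`.

For the comparison, `q - Q = O(|η|³)` bounds the difference of the slice integrals by `|t| / r²`.
Interpolating with `√(|r| / |t|)` gives `(|t| |r|)^{-1/8}`, and integration against `dr / |r|` over
`|r| > 1` leaves `|t|^{-1/8}` (`exists_rpow_mul_norm_sub_le`).

The rank alternative enters in `exists_chart`: either some direction `w` is available, or `q` and
`Q` vanish identically near `0` and the two integrals coincide. -/

noncomputable section

namespace PlanarJump

/-! ### Van der Corput estimates, on an interval, on the line and in several variables -/

/-- **Van der Corput's second derivative estimate** on a compact interval, for an amplitude that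
vanishes at the endpoints. -/
theorem norm_integral_mul_exp_le_of_le_second_deriv {A B : ℝ} (hAB : A ≤ B) {g g' : ℝ → ℂ}
    {h h₁ h₂ : ℝ → ℝ} {κ σ : ℝ} (hκ : 0 < κ) (hσ : |σ| = 1)
    (hg : ∀ s ∈ Set.Icc A B, HasDerivAt g (g' s) s) (hg' : ContinuousOn g' (Set.Icc A B))
    (hgA : g A = 0) (hgB : g B = 0)
    (hh : ∀ s ∈ Set.Icc A B, HasDerivAt h (h₁ s) s)
    (hh₁ : ∀ s ∈ Set.Icc A B, HasDerivAt h₁ (h₂ s) s) (hh₂ : ContinuousOn h₂ (Set.Icc A B))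
    (hle : ∀ s ∈ Set.Icc A B, κ ^ 2 ≤ σ * h₂ s) :
    ‖∫ s in A..B, g s * Complex.exp (Complex.I * (h s : ℂ))‖ ≤
      9 / κ * ∫ s in A..B, ‖g' s‖ := by
  have hu : Set.uIcc A B = Set.Icc A B := Set.uIcc_of_le hAB
  -- `m` is a regularization of `1 / h₁`, so zeros of `h₁` need no separate treatment. One has `m h₁
  -- = 1 - κ² / (h₁² + κ²)`; this defect and `|m'|` are both at most `D`, the derivative of `(σ / κ)
  -- arctan (h₁ / κ)`.
  set m : ℝ → ℝ := fun s => h₁ s / (h₁ s ^ 2 + κ ^ 2) with hm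
  set m' : ℝ → ℝ := fun s => (h₂ s * (κ ^ 2 - h₁ s ^ 2)) / (h₁ s ^ 2 + κ ^ 2) ^ 2 with hm'
  set e : ℝ → ℂ := fun s => Complex.exp (Complex.I * (h s : ℂ)) with he
  set D : ℝ → ℝ := fun s => σ * h₂ s / (h₁ s ^ 2 + κ ^ 2) with hD
  set V : ℝ := ∫ s in A..B, ‖g' s‖ with hV
  have hpos : ∀ s, 0 < h₁ s ^ 2 + κ ^ 2 := fun s => by positivity
  have hgc : ContinuousOn g (Set.Icc A B) := fun s hs => (hg s hs).continuousAt.continuousWithinAt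
  have hhc : ContinuousOn h (Set.Icc A B) := fun s hs => (hh s hs).continuousAt.continuousWithinAt
  have hh₁c : ContinuousOn h₁ (Set.Icc A B) :=
    fun s hs => (hh₁ s hs).continuousAt.continuousWithinAt
  have hec : ContinuousOn e (Set.Icc A B) := by
    apply Complex.continuous_exp.comp_continuousOn
    exact continuousOn_const.mul (Complex.continuous_ofReal.comp_continuousOn hhc)
  have hmc : ContinuousOn m (Set.Icc A B) :=
    hh₁c.div ((hh₁c.pow 2).add continuousOn_const) fun s _ => (hpos s).ne'
  have hm'c : ContinuousOn m' (Set.Icc A B) :=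
    (hh₂.mul (continuousOn_const.sub (hh₁c.pow 2))).div
      (((hh₁c.pow 2).add continuousOn_const).pow 2) fun s _ => (pow_pos (hpos s) 2).ne'
  have hDc : ContinuousOn D (Set.Icc A B) :=
    (continuousOn_const.mul hh₂).div ((hh₁c.pow 2).add continuousOn_const)
      fun s _ => (hpos s).ne'
  have hmd : ∀ s ∈ Set.Icc A B, HasDerivAt m (m' s) s := fun s hs => by
    refine ((hh₁ s hs).div (((hh₁ s hs).pow 2).add_const (κ ^ 2)) (hpos s).ne').congr_deriv ?_
    simp only [hm']
    congr 1
    simp only [Pi.pow_apply]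
    push_cast
    ring
  have hed : ∀ s ∈ Set.Icc A B, HasDerivAt e (e s * (Complex.I * (h₁ s : ℂ))) s := fun s hs =>
    (((hh s hs).ofReal_comp).const_mul Complex.I).cexp
  have hF : ∀ s ∈ Set.Icc A B, HasDerivAt (fun s => g s * (m s : ℂ) * e s)
      ((g' s * (m s : ℂ) + g s * (m' s : ℂ)) * e s
        + g s * (m s : ℂ) * (e s * (Complex.I * (h₁ s : ℂ)))) s := fun s hs =>
    ((hg s hs).mul ((hmd s hs).ofReal_comp)).mul (hed s hs)
  have hmC : ContinuousOn (fun s => (m s : ℂ)) (Set.Icc A B) :=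
    Complex.continuous_ofReal.comp_continuousOn hmc
  have hm'C : ContinuousOn (fun s => (m' s : ℂ)) (Set.Icc A B) :=
    Complex.continuous_ofReal.comp_continuousOn hm'c
  have hh₁C : ContinuousOn (fun s => (h₁ s : ℂ)) (Set.Icc A B) :=
    Complex.continuous_ofReal.comp_continuousOn hh₁c
  have h0 : ∫ s in A..B, ((g' s * (m s : ℂ) + g s * (m' s : ℂ)) * e s
        + g s * (m s : ℂ) * (e s * (Complex.I * (h₁ s : ℂ)))) = 0 := by
    rw [intervalIntegral.integral_eq_sub_of_hasDerivAt (f := fun s => g s * (m s : ℂ) * e s)]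
    · simp [hgA, hgB]
    · rw [hu]; exact hF
    · apply ContinuousOn.intervalIntegrable
      rw [hu]
      exact (((hg'.mul hmC).add (hgc.mul hm'C)).mul hec).add
        ((hgc.mul hmC).mul (hec.mul (continuousOn_const.mul hh₁C)))
  have hgV : ∀ s ∈ Set.Icc A B, ‖g s‖ ≤ V := fun s hs => by
    have hsub : Set.uIcc A s ⊆ Set.Icc A B := by
      rw [Set.uIcc_of_le hs.1]; exact Set.Icc_subset_Icc_right hs.2
    have h1 : g s = ∫ r in A..s, g' r := by
      rw [intervalIntegral.integral_eq_sub_of_hasDerivAt (f := g), hgA, sub_zero]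
      · exact fun x hx => hg x (hsub hx)
      · exact (hg'.mono hsub).intervalIntegrable
    rw [h1]
    refine (intervalIntegral.norm_integral_le_integral_norm hs.1).trans ?_
    refine intervalIntegral.integral_mono_interval le_rfl hs.1 hs.2
      (Eventually.of_forall fun _ => norm_nonneg _) ?_
    apply ContinuousOn.intervalIntegrable
    rw [hu]
    exact hg'.norm
  have hDint : ∫ s in A..B, D s ≤ 4 / κ := by
    have hd : ∀ s ∈ Set.Icc A B,
        HasDerivAt (fun s => σ / κ * Real.arctan (h₁ s / κ)) (D s) s := fun s hs => by
      refine ((((hh₁ s hs).div_const κ).arctan).const_mul (σ / κ)).congr_deriv ?_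
      have := hpos s
      simp only [hD]
      field_simp
      ring
    rw [intervalIntegral.integral_eq_sub_of_hasDerivAt
      (f := fun s => σ / κ * Real.arctan (h₁ s / κ))]
    · have hb : ∀ x, |Real.arctan x| ≤ 2 := fun x => by
        rw [abs_le]
        have := Real.arctan_lt_pi_div_two x
        have := Real.neg_pi_div_two_lt_arctan x
        have := Real.pi_le_four
        constructor <;> linarith
      have hb' : ∀ x, |σ / κ * Real.arctan x| ≤ 2 / κ := fun x => by
        rw [abs_mul, abs_div, hσ, abs_of_pos hκ, one_div_mul_eq_div]
        gcongr
        exact hb x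
      have h1 := abs_le.1 (hb' (h₁ B / κ))
      have h2 := abs_le.1 (hb' (h₁ A / κ))
      have h3 : 4 / κ = 2 / κ + 2 / κ := by ring
      linarith [h1.2, h2.1]
    · rw [hu]; exact hd
    · apply ContinuousOn.intervalIntegrable
      rw [hu]; exact hDc
  set R : ℝ → ℂ := fun s => Complex.I * g s * ((κ ^ 2 / (h₁ s ^ 2 + κ ^ 2) : ℝ) : ℂ) * e s
    - (g' s * (m s : ℂ) + g s * (m' s : ℂ)) * e s with hR
  have hRc : ContinuousOn R (Set.Icc A B) := by
    refine ContinuousOn.sub (((continuousOn_const.mul hgc).mul ?_).mul hec)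
      (((hg'.mul hmC).add (hgc.mul hm'C)).mul hec)
    exact Complex.continuous_ofReal.comp_continuousOn
      (continuousOn_const.div ((hh₁c.pow 2).add continuousOn_const) fun s _ => (hpos s).ne')
  -- Write `1 = m h₁ + κ² / (h₁² + κ²)`. The part with `m h₁` is integrated by parts through `h0`,
  -- without boundary terms.
  have hsplit : Complex.I * ∫ s in A..B, g s * e s = ∫ s in A..B, R s := by
    rw [← intervalIntegral.integral_const_mul, ← add_zero (∫ s in A..B, R s), ← h0,
      ← intervalIntegral.integral_add]
    · congr 1
      ext s
      have h1 : ((κ ^ 2 / (h₁ s ^ 2 + κ ^ 2) : ℝ) : ℂ) = 1 - (m s : ℂ) * (h₁ s : ℂ) := by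
        rw [← Complex.ofReal_one, ← Complex.ofReal_mul, ← Complex.ofReal_sub]
        congr 1
        have := hpos s
        simp only [hm]
        field_simp
        ring
      simp only [hR, h1]
      ring
    · apply ContinuousOn.intervalIntegrable
      rw [hu]; exact hRc
    · apply ContinuousOn.intervalIntegrable
      rw [hu]
      exact (((hg'.mul hmC).add (hgc.mul hm'C)).mul hec).add
        ((hgc.mul hmC).mul (hec.mul (continuousOn_const.mul hh₁C)))
  have hne : ∀ s, ‖e s‖ = 1 := fun s => by
    simp only [he]
    rw [mul_comm, Complex.norm_exp_ofReal_mul_I]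
  have hV0 : 0 ≤ V := intervalIntegral.integral_nonneg hAB fun _ _ => norm_nonneg _
  have hRb : ∀ s ∈ Set.Icc A B, ‖R s‖ ≤ 1 / (2 * κ) * ‖g' s‖ + 2 * V * D s := fun s hs => by
    have hp := hpos s
    have hh2 := hle s hs
    have hDs : 0 ≤ D s := div_nonneg ((sq_nonneg κ).trans hh2) hp.le
    have h1 : ‖((κ ^ 2 / (h₁ s ^ 2 + κ ^ 2) : ℝ) : ℂ)‖ ≤ D s := by
      rw [Complex.norm_real, Real.norm_of_nonneg (by positivity)]
      simp only [hD]
      gcongr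
    have h2 : ‖(m s : ℂ)‖ ≤ 1 / (2 * κ) := by
      rw [Complex.norm_real, Real.norm_eq_abs, hm, abs_div, abs_of_pos hp,
        div_le_div_iff₀ hp (by positivity)]
      nlinarith [sq_nonneg (|h₁ s| - κ), sq_abs (h₁ s)]
    have h3 : ‖(m' s : ℂ)‖ ≤ D s := by
      rw [Complex.norm_real, Real.norm_eq_abs]
      have e1 : |h₂ s| = σ * h₂ s := by
        rw [← abs_of_nonneg ((sq_nonneg κ).trans hh2), abs_mul, hσ, one_mul]
      have e2 : |κ ^ 2 - h₁ s ^ 2| ≤ h₁ s ^ 2 + κ ^ 2 := by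
        rw [abs_le]; constructor <;> nlinarith [sq_nonneg κ, sq_nonneg (h₁ s)]
      simp only [hm', hD]
      rw [abs_div, abs_mul, e1, abs_of_pos (pow_pos hp 2),
        div_le_div_iff₀ (pow_pos hp 2) hp, pow_two (h₁ s ^ 2 + κ ^ 2)]
      have e3 := (sq_nonneg κ).trans hh2
      calc σ * h₂ s * |κ ^ 2 - h₁ s ^ 2| * (h₁ s ^ 2 + κ ^ 2)
          ≤ σ * h₂ s * (h₁ s ^ 2 + κ ^ 2) * (h₁ s ^ 2 + κ ^ 2) := by gcongr
        _ = _ := by ring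
    calc ‖R s‖ ≤ ‖g s‖ * ‖((κ ^ 2 / (h₁ s ^ 2 + κ ^ 2) : ℝ) : ℂ)‖
          + (‖g' s‖ * ‖(m s : ℂ)‖ + ‖g s‖ * ‖(m' s : ℂ)‖) := by
          refine (norm_sub_le _ _).trans (add_le_add ?_ ?_)
          · rw [norm_mul, norm_mul, norm_mul, hne, Complex.norm_I, one_mul, mul_one]
          · rw [norm_mul, hne, mul_one]
            refine (norm_add_le _ _).trans ?_
            rw [norm_mul, norm_mul]
      _ ≤ V * D s + (‖g' s‖ * (1 / (2 * κ)) + V * D s) := by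
          have := hgV s hs
          gcongr
      _ = _ := by ring
  have hfin : ‖∫ s in A..B, R s‖ ≤ ∫ s in A..B, (1 / (2 * κ) * ‖g' s‖ + 2 * V * D s) := by
    refine (intervalIntegral.norm_integral_le_integral_norm hAB).trans ?_
    refine intervalIntegral.integral_mono_on hAB ?_ ?_ hRb <;>
      apply ContinuousOn.intervalIntegrable <;> rw [hu]
    · exact hRc.norm
    · exact (continuousOn_const.mul hg'.norm).add (continuousOn_const.mul hDc)
  have hI : ‖∫ s in A..B, g s * e s‖ = ‖∫ s in A..B, R s‖ := by
    rw [← hsplit, norm_mul, Complex.norm_I, one_mul]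
  rw [hI]
  refine hfin.trans ?_
  rw [intervalIntegral.integral_add, intervalIntegral.integral_const_mul,
    intervalIntegral.integral_const_mul, ← hV]
  · calc 1 / (2 * κ) * V + 2 * V * ∫ s in A..B, D s
        ≤ 1 / (2 * κ) * V + 2 * V * (4 / κ) := by gcongr
      -- `1/2 + 2 · 4 = 17/2`, rounded up to `9`.
      _ ≤ 9 / κ * V := by
        have h3 : 1 / (2 * κ) * V + 2 * V * (4 / κ) = (17 / 2) * (V / κ) := by field_simp; ring
        have h4 : 9 / κ * V = 9 * (V / κ) := by ring
        rw [h3, h4]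
        gcongr
        norm_num
  · apply ContinuousOn.intervalIntegrable
    rw [hu]; exact continuousOn_const.mul hg'.norm
  · apply ContinuousOn.intervalIntegrable
    rw [hu]; exact continuousOn_const.mul hDc

/-- Van der Corput's estimate on the line, for a compactly supported amplitude. -/
theorem norm_integral_mul_exp_le_of_hasCompactSupport {S : Set ℝ} (hSo : IsOpen S)
    (hSc : S.OrdConnected) {g g' : ℝ → ℂ} {h h₁ h₂ : ℝ → ℝ} {κ σ : ℝ} (hκ : 0 < κ) (hσ : |σ| = 1)
    (hg : ∀ s, HasDerivAt g (g' s) s) (hg' : Continuous g')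
    (hgc : HasCompactSupport g) (hgS : tsupport g ⊆ S)
    (hh : ∀ s ∈ S, HasDerivAt h (h₁ s) s)
    (hh₁ : ∀ s ∈ S, HasDerivAt h₁ (h₂ s) s) (hh₂ : ContinuousOn h₂ S)
    (hle : ∀ s ∈ S, κ ^ 2 ≤ σ * h₂ s) :
    ‖∫ s, g s * Complex.exp (Complex.I * (h s : ℂ))‖ ≤ 9 / κ * ∫ s, ‖g' s‖ := by
  have hR : 0 ≤ 9 / κ * ∫ s, ‖g' s‖ :=
    mul_nonneg (by positivity) (integral_nonneg fun _ => norm_nonneg _)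
  rcases (tsupport g).eq_empty_or_nonempty with h0 | hne
  · have : g = 0 := tsupport_eq_empty_iff.1 h0
    simpa [this] using hR
  have hK : IsCompact (tsupport g) := hgc
  obtain ⟨δ, hδ, hδS⟩ := Metric.isOpen_iff.1 hSo _ (hgS (hK.sInf_mem hne))
  obtain ⟨δ', hδ', hδS'⟩ := Metric.isOpen_iff.1 hSo _ (hgS (hK.sSup_mem hne))
  set A := sInf (tsupport g) - δ / 2 with hA
  set B := sSup (tsupport g) + δ' / 2 with hB
  have hAS : A ∈ S := hδS (by
    rw [Metric.mem_ball, Real.dist_eq, hA, abs_lt]; constructor <;> linarith)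
  have hBS : B ∈ S := hδS' (by
    rw [Metric.mem_ball, Real.dist_eq, hB, abs_lt]; constructor <;> linarith)
  have hKA : ∀ s ∈ tsupport g, A < s := fun s hs => by
    have := csInf_le hK.bddBelow hs
    linarith
  have hKB : ∀ s ∈ tsupport g, s < B := fun s hs => by
    have := le_csSup hK.bddAbove hs
    linarith
  have hAB : A ≤ B := by
    obtain ⟨s, hs⟩ := hne
    exact ((hKA s hs).trans (hKB s hs)).le
  have hsub : Set.Icc A B ⊆ S := hSc.out hAS hBS
  have hgA : g A = 0 := image_eq_zero_of_notMem_tsupport fun h => (hKA A h).false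
  have hgB : g B = 0 := image_eq_zero_of_notMem_tsupport fun h => (hKB B h).false
  have key := norm_integral_mul_exp_le_of_le_second_deriv hAB hκ hσ (fun s _ => hg s)
    hg'.continuousOn hgA hgB (fun s hs => hh s (hsub hs)) (fun s hs => hh₁ s (hsub hs))
    (hh₂.mono hsub) (fun s hs => hle s (hsub hs))
  have hsupp : Function.support (fun s => g s * Complex.exp (Complex.I * (h s : ℂ)))
      ⊆ Set.Ioc A B := fun s hs => by
    have : s ∈ tsupport g := subset_tsupport g fun h => hs (by simp [h])
    exact ⟨hKA s this, (hKB s this).le⟩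
  have hd : g' = deriv g := funext fun s => ((hg s).deriv).symm
  have hsupp' : Function.support (fun s => ‖g' s‖) ⊆ Set.Ioc A B := fun s hs => by
    have : s ∈ tsupport g := by
      refine (support_deriv_subset (f := g)) ?_
      rw [← hd]
      exact fun h => hs (by simp [h])
    exact ⟨hKA s this, (hKB s this).le⟩
  rwa [intervalIntegral.integral_eq_integral_of_support_subset hsupp,
    intervalIntegral.integral_eq_integral_of_support_subset hsupp'] at key

/-- Fubini along parallel lines: an inequality between the integrals over all lines in a given
direction passes to the integrals over the whole space. -/
theorem norm_integral_le_of_forall_line {E : Type*} [NormedAddCommGroup E] [NormedSpace ℝ E]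
    [FiniteDimensional ℝ E] [MeasurableSpace E] [BorelSpace E] (μ : Measure E)
    [μ.IsAddHaarMeasure] {w : E} (hw : w ≠ 0) {F : E → ℂ} {P : E → ℝ}
    (hF : Integrable F μ) (hP : Integrable P μ)
    (h : ∀ η, ‖∫ s : ℝ, F (η + s • w)‖ ≤ ∫ s : ℝ, P (η + s • w)) :
    ‖∫ η, F η ∂μ‖ ≤ ∫ η, P η ∂μ := by
  have : Nontrivial E := nontrivial_iff.2 ⟨w, 0, hw⟩
  let E' := Fin (Module.finrank ℝ E - 1) → ℝ
  -- Linear coordinates in which `w` is the last basis vector. They carry `μ` to a multiple `c` of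
  -- Lebesgue measure, and `c` cancels from the two sides of the inequality.
  obtain ⟨L, hL⟩ : ∃ L : E ≃L[ℝ] (E' × ℝ), L w = (0, 1) := by
    have : Module.finrank ℝ (E' × ℝ) = Module.finrank ℝ E := by
      simpa [E'] using Nat.sub_add_cancel Module.finrank_pos
    have L₀ : E ≃L[ℝ] (E' × ℝ) := (ContinuousLinearEquiv.ofFinrankEq this).symm
    obtain ⟨M, hM⟩ : ∃ M : (E' × ℝ) ≃L[ℝ] (E' × ℝ), M (L₀ w) = (0, 1) := by
      apply SeparatingDual.exists_continuousLinearEquiv_apply_eq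
      · simpa using hw
      · simp
    exact ⟨L₀.trans M, by simp [hM]⟩
  have L_emb : MeasurableEmbedding L := L.toHomeomorph.measurableEmbedding
  let ρ : Measure (E' × ℝ) := (volume : Measure E').prod volume
  have : (Measure.map L μ).IsAddHaarMeasure := L.isAddHaarMeasure_map μ
  set c := Measure.addHaarScalarFactor (Measure.map L μ) ρ with hc
  have hν : Measure.map L μ = c • ρ := Measure.isAddLeftInvariant_eq_smul _ _
  have hc0 : c ≠ 0 := (Measure.addHaarScalarFactor_pos_of_isAddHaarMeasure _ _).ne'
  have key : ∀ {V : Type} [NormedAddCommGroup V] [NormedSpace ℝ V] [CompleteSpace V] (f : E → V),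
      Integrable f μ → Integrable (fun z => f (L.symm z)) ρ ∧
        ∫ η, f η ∂μ = (c : ℝ) • ∫ y, ∫ s, f (L.symm (y, s)) := by
    intro V _ _ _ f hf
    have h1 : Integrable (fun z => f (L.symm z)) (Measure.map L μ) := by
      rw [L_emb.integrable_map_iff]
      simpa [Function.comp_def] using hf
    have h2 : Integrable (fun z => f (L.symm z)) ρ := by
      rw [hν] at h1
      have := h1.smul_measure_nnreal (c := c⁻¹)
      rwa [smul_smul, inv_mul_cancel₀ hc0, one_smul] at this
    refine ⟨h2, ?_⟩
    have h3 : ∫ η, f η ∂μ = ∫ z, f (L.symm z) ∂(Measure.map L μ) := by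
      rw [L_emb.integral_map]
      simp
    rw [h3, hν, integral_smul_nnreal_measure, integral_prod _ h2]
    rfl
  have hline : ∀ (y : E') (s : ℝ), L.symm (y, s) = L.symm (y, 0) + s • w := fun y s => by
    apply L.injective
    simp [hL]
  obtain ⟨hF1, hF2⟩ := key F hF
  obtain ⟨hP1, hP2⟩ := key P hP
  rw [hF2, hP2, norm_smul, smul_eq_mul, Real.norm_of_nonneg c.coe_nonneg]
  gcongr
  refine (norm_integral_le_integral_norm _).trans ?_
  refine integral_mono hF1.integral_prod_left.norm hP1.integral_prod_left fun y => ?_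
  have e1 : (fun s => F (L.symm (y, s))) = fun s => F (L.symm (y, 0) + s • w) :=
    funext fun s => congrArg F (hline y s)
  have e2 : (fun s => P (L.symm (y, s))) = fun s => P (L.symm (y, 0) + s • w) :=
    funext fun s => congrArg P (hline y s)
  simp only [e1, e2]
  exact h (L.symm (y, 0))

/-- Van der Corput's estimate in several variables: only the second derivative of the phase in one
direction is involved. -/
theorem norm_integral_mul_exp_le_of_lineDeriv {E : Type*} [NormedAddCommGroup E] [NormedSpace ℝ E]
    [FiniteDimensional ℝ E] [MeasurableSpace E] [BorelSpace E] (μ : Measure E)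
    [μ.IsAddHaarMeasure] {w : E} (hw : w ≠ 0) {U : Set E} (hUo : IsOpen U) (hUc : Convex ℝ U)
    {g : E → ℂ} (hg : ContDiff ℝ 1 g) (hgc : HasCompactSupport g) (hgU : tsupport g ⊆ U)
    {h h₁ h₂ : E → ℝ} {κ σ : ℝ} (hκ : 0 < κ) (hσ : |σ| = 1)
    (hhc : ContinuousOn h U) (hh : ∀ η ∈ U, HasLineDerivAt ℝ h (h₁ η) η w)
    (hh₁ : ∀ η ∈ U, HasLineDerivAt ℝ h₁ (h₂ η) η w) (hh₂ : ContinuousOn h₂ U)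
    (hle : ∀ η ∈ U, κ ^ 2 ≤ σ * h₂ η) :
    ‖∫ η, g η * Complex.exp (Complex.I * (h η : ℂ)) ∂μ‖ ≤
      9 / κ * ∫ η, ‖fderiv ℝ g η w‖ ∂μ := by
  have hgd : Differentiable ℝ g := hg.differentiable one_ne_zero
  have hg'c : Continuous fun η => fderiv ℝ g η w :=
    (hg.continuous_fderiv one_ne_zero).clm_apply continuous_const
  have hgi : Integrable g μ := hg.continuous.integrable_of_hasCompactSupport hgc
  -- `h` is only controlled on `U`; off the support of `g` the integrand vanishes locally.
  have hcont : Continuous fun η => g η * Complex.exp (Complex.I * (h η : ℂ)) := by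
    rw [continuous_iff_continuousAt]
    intro η
    by_cases hη : η ∈ tsupport g
    · have hu : ContinuousAt h η := hhc.continuousAt (hUo.mem_nhds (hgU hη))
      refine hg.continuous.continuousAt.mul ?_
      exact (Complex.continuous_exp.continuousAt).comp
        (continuousAt_const.mul (Complex.continuous_ofReal.continuousAt.comp hu))
    · have : (fun η => g η * Complex.exp (Complex.I * (h η : ℂ))) =ᶠ[𝓝 η] fun _ => 0 := by
        filter_upwards [notMem_tsupport_iff_eventuallyEq.1 hη] with x hx
        simp [hx]
      exact this.continuousAt
  have hFi : Integrable (fun η => g η * Complex.exp (Complex.I * (h η : ℂ))) μ := by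
    refine hgi.mono hcont.aestronglyMeasurable (Eventually.of_forall fun η => ?_)
    rw [norm_mul, mul_comm Complex.I, Complex.norm_exp_ofReal_mul_I, mul_one]
  have hPi : Integrable (fun η => 9 / κ * ‖fderiv ℝ g η w‖) μ := by
    refine ((hg'c.integrable_of_hasCompactSupport ?_).norm).const_mul _
    exact (hgc.fderiv ℝ).comp_left (g := fun T : E →L[ℝ] ℂ => T w) rfl
  rw [← integral_const_mul]
  refine norm_integral_le_of_forall_line μ hw hFi hPi fun η => ?_
  rw [integral_const_mul]
  have hlc : Continuous fun s : ℝ => η + s • w := by fun_prop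
  have hld : ∀ s : ℝ, HasDerivAt (fun s : ℝ => η + s • w) w s := fun s => by
    simpa using ((hasDerivAt_id s).smul_const w).const_add η
  have hline : ∀ {f : E → ℝ} {f' : ℝ} {s : ℝ}, HasLineDerivAt ℝ f f' (η + s • w) w →
      HasDerivAt (fun s : ℝ => f (η + s • w)) f' s := by
    intro f f' s hf
    have h1 : HasDerivAt (fun r : ℝ => f (η + s • w + r • w)) f' (s - s) := by
      rw [sub_self]; exact hf
    have := h1.comp_sub_const s s
    refine this.congr_of_eventuallyEq (Eventually.of_forall fun r => ?_)
    simp only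
    congr 1
    module
  refine norm_integral_mul_exp_le_of_hasCompactSupport (S := (fun s : ℝ => η + s • w) ⁻¹' U)
    (hUo.preimage hlc) ?_ hκ hσ (g' := fun s => fderiv ℝ g (η + s • w) w)
    (h₁ := fun s => h₁ (η + s • w)) (h₂ := fun s => h₂ (η + s • w))
    (fun s => (hgd _).hasFDerivAt.comp_hasDerivAt s (hld s)) (hg'c.comp hlc) ?_ ?_
    (fun s hs => hline (hh _ hs)) (fun s hs => hline (hh₁ _ hs)) ?_ (fun s hs => hle _ hs)
  · refine Convex.ordConnected fun s hs t ht p q hp hq hpq => ?_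
    have := hUc hs ht hp hq hpq
    have e : p • (η + s • w) + q • (η + t • w) = (p + q) • η + (p • s + q • t) • w := by
      simp only [smul_eq_mul]
      module
    rw [e, hpq, one_smul] at this
    exact this
  · refine hgc.comp_isClosedEmbedding (g := fun s : ℝ => η + s • w) ?_
    exact (Homeomorph.addLeft η).isClosedEmbedding.comp (isClosedEmbedding_smul_left hw)
  · exact (tsupport_comp_subset_preimage g hlc).trans (Set.preimage_mono hgU)
  · exact hh₂.comp hlc.continuousOn fun s hs => hs

/-! ### The sine integral and one-dimensional oscillatory principal values -/

theorem integrable_comp_abs {f : ℝ → ℝ} (hf : IntegrableOn f (Set.Ioi 0)) :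
    Integrable fun x => f |x| := by
  have hpos : IntegrableOn (fun x => f |x|) (Set.Ioi 0) := by
    refine hf.congr_fun (fun x hx => ?_) measurableSet_Ioi
    rw [abs_of_pos hx]
  have hneg : IntegrableOn (fun x => f |x|) (Set.Iic 0) := by
    rw [← Measure.map_neg_eq_self (volume : Measure ℝ)]
    have m : MeasurableEmbedding fun x : ℝ => -x := (Homeomorph.neg ℝ).measurableEmbedding
    rw [m.integrableOn_map_iff]
    simp_rw [Function.comp_def, abs_neg, Set.neg_preimage, Set.neg_Iic, neg_zero]
    exact Iff.mpr integrableOn_Ici_iff_integrableOn_Ioi hpos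
  rw [← integrableOn_univ, ← Set.Iic_union_Ioi (a := (0 : ℝ))]
  exact hneg.union hpos

/-- The sine integral `∫₀ˣ sin s / s ds`. -/
def sineIntegral (x : ℝ) : ℝ := ∫ s in 0..x, Real.sinc s

theorem sineIntegral_neg (x : ℝ) : sineIntegral (-x) = -sineIntegral x := by
  unfold sineIntegral
  have := intervalIntegral.integral_comp_neg (a := 0) (b := x) Real.sinc
  simp only [Real.sinc_neg, neg_zero] at this
  rw [this, intervalIntegral.integral_symm]

theorem hasDerivAt_sineIntegral (x : ℝ) : HasDerivAt sineIntegral (Real.sinc x) x :=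
  intervalIntegral.integral_hasDerivAt_right (Real.continuous_sinc.intervalIntegrable _ _)
    (Real.continuous_sinc.stronglyMeasurableAtFilter _ _) Real.continuous_sinc.continuousAt

/-- Integration by parts: `sineIntegral s + cos s / s` has derivative `-cos s / s²`, which is
integrable at infinity, and `cos s / s` tends to zero. -/
theorem exists_tendsto_sineIntegral : ∃ L, Tendsto sineIntegral atTop (𝓝 L) := by
  have hint : IntegrableOn (fun s : ℝ => Real.cos s / s ^ 2) (Set.Ioi 1) := by
    have h1 := integrableOn_Ioi_rpow_of_lt (a := -2) (c := 1) (by norm_num) one_pos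
    refine Integrable.mono h1 ?_ ?_
    · exact (Real.measurable_cos.div (measurable_id.pow_const 2)).aestronglyMeasurable
    · filter_upwards [ae_restrict_mem measurableSet_Ioi] with s hs
      have hs0 : 0 < s := one_pos.trans hs
      rw [norm_div, Real.norm_of_nonneg (sq_nonneg s), Real.rpow_neg hs0.le,
        Real.rpow_two, norm_inv, Real.norm_of_nonneg (sq_nonneg s), ← one_div]
      gcongr
      exact Real.abs_cos_le_one s
  have hlim := intervalIntegral_tendsto_integral_Ioi 1 hint tendsto_id
  have hcos : Tendsto (fun x : ℝ => Real.cos x / x) atTop (𝓝 0) :=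
    tendsto_of_tendsto_of_tendsto_of_le_of_le' (tendsto_inv_atTop_zero.neg.trans (by simp))
      tendsto_inv_atTop_zero
      (by
        filter_upwards [eventually_gt_atTop 0] with x hx
        rw [← one_div, ← neg_div]
        gcongr
        exact Real.neg_one_le_cos x)
      (by
        filter_upwards [eventually_gt_atTop 0] with x hx
        rw [← one_div]
        gcongr
        exact Real.cos_le_one x)
  refine ⟨_, (((tendsto_const_nhds (x := sineIntegral 1 + Real.cos 1)).sub hcos).sub hlim).congr'
    ?_⟩
  filter_upwards [eventually_ge_atTop 1] with x hx
  have hmem : ∀ s ∈ Set.uIcc 1 x, 0 < s := fun s hs => by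
    rw [Set.uIcc_of_le hx] at hs
    exact one_pos.trans_le hs.1
  have hd : ∀ s ∈ Set.uIcc 1 x, HasDerivAt (fun s => sineIntegral s + Real.cos s / s)
      (-(Real.cos s / s ^ 2)) s := fun s hs => by
    have hs0 := (hmem s hs).ne'
    refine ((hasDerivAt_sineIntegral s).add
      ((Real.hasDerivAt_cos s).div (hasDerivAt_id s) hs0)).congr_deriv ?_
    rw [Real.sinc_of_ne_zero hs0]
    simp only [id]
    field_simp
    ring
  have hi : IntervalIntegrable (fun s : ℝ => -(Real.cos s / s ^ 2)) volume 1 x := by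
    apply ContinuousOn.intervalIntegrable
    exact (Real.continuous_cos.continuousOn.div (continuousOn_id.pow 2)
      fun s hs => pow_ne_zero 2 (hmem s hs).ne').neg
  have := intervalIntegral.integral_eq_sub_of_hasDerivAt hd hi
  rw [intervalIntegral.integral_neg] at this
  simp only [id, div_one] at this ⊢
  linarith

theorem exists_abs_sineIntegral_le : ∃ C, ∀ x, |sineIntegral x| ≤ C := by
  obtain ⟨L, hL⟩ := exists_tendsto_sineIntegral
  have hc : Continuous sineIntegral :=
    continuous_iff_continuousAt.2 fun x => (hasDerivAt_sineIntegral x).continuousAt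
  obtain ⟨X, hX⟩ := eventually_atTop.1 (hL.abs.eventually_le_const (lt_add_one (|L| : ℝ)))
  obtain ⟨C, hC⟩ := (isCompact_Icc (a := 0) (b := X)).exists_bound_of_continuousOn
    hc.continuousOn
  have hpos : ∀ x, 0 ≤ x → |sineIntegral x| ≤ max C (|L| + 1) := fun x hx => by
    rcases le_total x X with h | h
    · exact (hC x ⟨hx, h⟩).trans (le_max_left _ _)
    · exact (hX x h).trans (le_max_right _ _)
  refine ⟨max C (|L| + 1), fun x => ?_⟩
  rcases le_total 0 x with h | h
  · exact hpos x h
  · have := hpos (-x) (neg_nonneg.2 h)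
    rwa [sineIntegral_neg, abs_neg] at this

/-- Slabs of the real line are intervals. -/
theorem setOf_abs_le_eq_Icc (R : ℝ) : {r : ℝ | |r| ≤ R} = Set.Icc (-R) R := by
  ext r
  exact abs_le (a := r) (b := R)

/-- The principal value at infinity of `e^{iyr} / r` over `|r| > T` exists and is bounded
uniformly in `y` and `T`. -/
theorem exists_tendsto_integral_exp_div : ∃ C : ℝ, 0 ≤ C ∧ ∀ (y T : ℝ), 0 < T → ∃ L : ℂ,
    ‖L‖ ≤ C ∧ Tendsto (fun R : ℝ => ∫ r in {r : ℝ | |r| ≤ R},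
      {r : ℝ | T < |r|}.indicator (fun r : ℝ => Complex.exp (Complex.I * (y * r : ℝ)) / r) r)
      atTop (𝓝 L) := by
  obtain ⟨C, hC⟩ := exists_abs_sineIntegral_le
  have hC0 : 0 ≤ C := (abs_nonneg (sineIntegral 0)).trans (hC 0)
  obtain ⟨L, hL⟩ := exists_tendsto_sineIntegral
  refine ⟨4 * C, by positivity, fun y T hT => ?_⟩
  -- The limit depends only on the sign of `y`, which is why the bound is uniform in `y`.
  obtain ⟨L', hL'⟩ : ∃ L', Tendsto (fun R => sineIntegral (y * R)) atTop (𝓝 L') := by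
    rcases lt_trichotomy y 0 with hy | rfl | hy
    · refine ⟨-L, ?_⟩
      have := (hL.comp (tendsto_id.const_mul_atTop (neg_pos.2 hy))).neg
      refine this.congr fun R => ?_
      simp only [Function.comp, id]
      rw [← sineIntegral_neg]
      congr 1
      ring
    · exact ⟨sineIntegral 0, by simp⟩
    · exact ⟨L, hL.comp (tendsto_id.const_mul_atTop hy)⟩
  set f : ℝ → ℂ := fun r : ℝ => Complex.exp (Complex.I * (y * r : ℝ)) / r with hf
  -- Folding `r` and `-r` together cancels the cosine and leaves `2i sin(yr) / r`, whose integral is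
  -- a difference of sine integrals.
  have hval : ∀ R, T ≤ R → ∫ r in {r : ℝ | |r| ≤ R}, {r : ℝ | T < |r|}.indicator f r =
      ((sineIntegral (y * R) - sineIntegral (y * T) : ℝ) : ℂ) * (2 * Complex.I) := by
    intro R hR
    have hcf : ∀ a b : ℝ, 0 < a → a ≤ b → IntervalIntegrable f volume a b ∧
        IntervalIntegrable f volume (-b) (-a) := by
      intro a b ha hab
      have hc : ContinuousOn f {0}ᶜ := by
        apply ContinuousOn.div
        · fun_prop
        · fun_prop
        · intro r hr
          simpa using hr
      constructor
      · apply (hc.mono _).intervalIntegrable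
        rw [Set.uIcc_of_le hab]
        intro r hr h0
        rw [Set.mem_singleton_iff.1 h0] at hr
        linarith [hr.1]
      · apply (hc.mono _).intervalIntegrable
        rw [Set.uIcc_of_le (neg_le_neg hab)]
        intro r hr h0
        rw [Set.mem_singleton_iff.1 h0] at hr
        linarith [hr.2]
    have hm : MeasurableSet {r : ℝ | T < |r|} :=
      (isOpen_lt continuous_const continuous_abs).measurableSet
    have hset : {r : ℝ | |r| ≤ R} ∩ {r : ℝ | T < |r|} = Set.Ico (-R) (-T) ∪ Set.Ioc T R := by
      ext r
      simp only [Set.mem_inter_iff, Set.mem_ofPred_eq, Set.mem_union, Set.mem_Ico, Set.mem_Ioc,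
        abs_le, lt_abs]
      constructor
      · rintro ⟨⟨h1, h2⟩, h3 | h3⟩
        · exact Or.inr ⟨h3, h2⟩
        · exact Or.inl ⟨h1, by linarith⟩
      · rintro (⟨h1, h2⟩ | ⟨h1, h2⟩)
        · exact ⟨⟨h1, by linarith⟩, Or.inr (by linarith)⟩
        · exact ⟨⟨by linarith, h2⟩, Or.inl h1⟩
    have hdis : Disjoint (Set.Ico (-R) (-T)) (Set.Ioc T R) := by
      rw [Set.disjoint_left]
      intro r h1 h2
      linarith [h1.2, h2.1]
    have hi1 := (hcf T R hT hR).1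
    have hi2 := (hcf T R hT hR).2
    have hneg : ∫ r in (-R)..(-T), f r = ∫ r in T..R, f (-r) := by
      rw [intervalIntegral.integral_comp_neg]
    have hi3 : IntervalIntegrable (fun r => f (-r)) volume T R := by
      have := (Iff.mp IntervalIntegrable.iff_comp_neg hi2).symm
      simpa using this
    rw [setIntegral_indicator hm, hset, setIntegral_union hdis measurableSet_Ioc
      (((intervalIntegrable_iff_integrableOn_Ioc_of_le (neg_le_neg hR)).1 hi2).congr_set_ae
        Ico_ae_eq_Ioc)
      ((intervalIntegrable_iff_integrableOn_Ioc_of_le hR).1 hi1), integral_Ico_eq_integral_Ioc,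
      ← intervalIntegral.integral_of_le hR, ← intervalIntegral.integral_of_le (neg_le_neg hR),
      hneg, ← intervalIntegral.integral_add hi3 hi1]
    have hmem : ∀ r ∈ Set.uIcc T R, 0 < r := fun r hr => by
      rw [Set.uIcc_of_le hR] at hr
      exact hT.trans_le hr.1
    rw [← intervalIntegral.integral_eq_sub_of_hasDerivAt (f := fun r => sineIntegral (y * r))
      (f' := fun r => Real.sinc (y * r) * y), ← intervalIntegral.integral_ofReal,
      ← intervalIntegral.integral_mul_const]
    · refine intervalIntegral.integral_congr fun r hr => ?_
      have hr0 := (hmem r hr).ne'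
      have e1 : Real.sinc (y * r) * y = Real.sin (y * r) / r := by
        rcases eq_or_ne y 0 with rfl | hy
        · simp
        · rw [Real.sinc_of_ne_zero (mul_ne_zero hy hr0)]
          field_simp
      have e2 : Complex.exp (Complex.I * (y * r : ℝ)) - Complex.exp (Complex.I * (y * -r : ℝ)) =
          (Real.sin (y * r) : ℂ) * (2 * Complex.I) := by
        rw [mul_comm Complex.I, mul_comm Complex.I, mul_neg, Complex.ofReal_neg,
          Complex.exp_mul_I, Complex.exp_mul_I, Complex.cos_neg, Complex.sin_neg,
          Complex.ofReal_sin]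
        ring
      simp only [hf, e1]
      rw [Complex.ofReal_div, div_mul_eq_mul_div, ← e2, Complex.ofReal_neg r]
      field_simp
      ring
    · intro r _
      have h1 : HasDerivAt (fun r : ℝ => y * r) y r := by
        simpa using (hasDerivAt_id r).const_mul y
      exact (hasDerivAt_sineIntegral (y * r)).comp r h1
    · exact ((Real.continuous_sinc.comp (continuous_const.mul continuous_id)).mul
        continuous_const).intervalIntegrable _ _
  refine ⟨((L' - sineIntegral (y * T) : ℝ) : ℂ) * (2 * Complex.I), ?_, ?_⟩
  · have h1 : |L'| ≤ C := le_of_tendsto hL'.abs (Eventually.of_forall fun R => hC _)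
    rw [norm_mul, Complex.norm_real, norm_mul, Complex.norm_I, Complex.norm_ofNat, mul_one]
    have := (abs_sub L' (sineIntegral (y * T))).trans (add_le_add h1 (hC _))
    rw [Real.norm_eq_abs]
    linarith
  · have : Tendsto (fun R => ((sineIntegral (y * R) - sineIntegral (y * T) : ℝ) : ℂ)
        * (2 * Complex.I)) atTop (𝓝 (((L' - sineIntegral (y * T) : ℝ) : ℂ) * (2 * Complex.I))) :=
      ((Complex.continuous_ofReal.tendsto _).comp (hL'.sub_const _)).mul_const _
    refine this.congr' ?_
    filter_upwards [eventually_ge_atTop T] with R hR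
    exact (hval R hR).symm

/-- A profile with an integrable singularity at the origin and integrable tails. -/
def tailProfile (s : ℝ) : ℝ := if s ≤ 1 then s ^ (-(1 / 2) : ℝ) else s ^ (-2 : ℝ)

theorem integrable_tailProfile_abs : Integrable fun s : ℝ => tailProfile |s| := by
  apply integrable_comp_abs
  rw [← Set.Ioc_union_Ioi_eq_Ioi (zero_le_one (α := ℝ))]
  refine IntegrableOn.union ?_ ?_
  · have : IntervalIntegrable (fun s : ℝ => s ^ (-(1 / 2) : ℝ)) volume 0 1 :=
      intervalIntegral.intervalIntegrable_rpow' (by norm_num)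
    rw [intervalIntegrable_iff_integrableOn_Ioc_of_le zero_le_one] at this
    refine this.congr_fun (fun s hs => ?_) measurableSet_Ioc
    simp [tailProfile, hs.2]
  · refine (integrableOn_Ioi_rpow_of_lt (a := -2) (by norm_num) one_pos).congr_fun
      (fun s hs => ?_) measurableSet_Ioi
    simp [tailProfile, not_le.2 (Set.mem_Ioi.1 hs)]

/-- One-dimensional oscillatory principal values: if `H` is at most `K √(|r| / T)` for `|r| ≤ T`
and differs from a constant by at most `K T / |r|` for `|r| > T`, then the principal value of
`H(r) e^{iyr} / r` exists and is bounded by a universal multiple of `K`. -/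
theorem exists_tendsto_integral_mul_exp_div : ∃ C : ℝ, 0 ≤ C ∧
    ∀ (H : ℝ → ℂ) (J : ℂ) (K T y : ℝ), 0 < T → AEStronglyMeasurable H volume →
    (∀ r, |r| ≤ T → ‖H r‖ ≤ K * Real.sqrt (|r| / T)) →
    (∀ r, T < |r| → ‖H r - J‖ ≤ K * (T / |r|)) → ‖J‖ ≤ K →
    ∃ u : ℂ, ‖u‖ ≤ C * K ∧ Tendsto (fun R : ℝ => ∫ r in {r : ℝ | |r| ≤ R},
      H r * (Complex.exp (Complex.I * (y * r : ℝ)) / r)) atTop (𝓝 u) := by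
  obtain ⟨C, hC0, hC⟩ := exists_tendsto_integral_exp_div
  set m : ℝ := ∫ s : ℝ, tailProfile |s| with hm
  have hm0 : 0 ≤ m := integral_nonneg fun s => by
    simp only [tailProfile]
    split_ifs <;> positivity
  refine ⟨m + C, by positivity, fun H J K T y hT hH h1 h2 hJ => ?_⟩
  have hK : 0 ≤ K := (norm_nonneg J).trans hJ
  obtain ⟨L, hLC, hL⟩ := hC y T hT
  set e : ℝ → ℂ := fun r : ℝ => Complex.exp (Complex.I * (y * r : ℝ)) / r with he
  set S : Set ℝ := {r : ℝ | T < |r|} with hS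
  have hSm : MeasurableSet S := (isOpen_lt continuous_const continuous_abs).measurableSet
  have hem : Measurable e := by
    refine Measurable.div ?_ (by fun_prop)
    exact Continuous.measurable (by fun_prop)
  -- Removing the constant `J` beyond `T` leaves an absolutely integrable function; only `J e^{iyr}
  -- / r` on `|r| > T` needs cancellation.
  set D : ℝ → ℂ := fun r => (H r - S.indicator (fun _ => J) r) * e r with hD
  -- This also holds at `r = 0`, where both sides are zero by the convention for division.
  have hne : ∀ r, ‖e r‖ = 1 / |r| := fun r => by
    simp only [he]
    rw [norm_div, mul_comm, Complex.norm_exp_ofReal_mul_I, Complex.norm_real, Real.norm_eq_abs]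
  -- The majorant is a profile dilated by `T` and normalized by `T⁻¹`, so its integral `K m` does
  -- not depend on `T`.
  have hbound : ∀ r, ‖D r‖ ≤ K * (T⁻¹ * tailProfile |r / T|) := fun r => by
    simp only [hD]
    rw [norm_mul, hne, abs_div, abs_of_pos hT]
    rcases eq_or_ne r 0 with rfl | hr
    · simp only [abs_zero, zero_div, div_zero, mul_zero]
      have : 0 ≤ tailProfile 0 := by
        simp only [tailProfile]
        split_ifs <;> positivity
      positivity
    have hr' : 0 < |r| := abs_pos.2 hr
    by_cases hrT : T < |r|
    · have h3 : ¬ |r| / T ≤ 1 := by rwa [not_le, one_lt_div hT]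
      rw [Set.indicator_of_mem (show r ∈ S from hrT), tailProfile, if_neg h3,
        Real.rpow_neg (by positivity), Real.rpow_two]
      calc ‖H r - J‖ * (1 / |r|) ≤ K * (T / |r|) * (1 / |r|) := by gcongr; exact h2 r hrT
        _ = _ := by field_simp
    · have h3 : |r| / T ≤ 1 := by rw [div_le_one hT]; exact not_lt.1 hrT
      rw [Set.indicator_of_notMem (show r ∉ S from hrT), tailProfile, if_pos h3, sub_zero,
        Real.rpow_neg (by positivity), ← Real.sqrt_eq_rpow]
      calc ‖H r‖ * (1 / |r|) ≤ K * Real.sqrt (|r| / T) * (1 / |r|) := by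
            gcongr; exact h1 r (not_lt.1 hrT)
        _ = K * (T⁻¹ * (Real.sqrt (|r| / T))⁻¹) := by
          have h4 : 0 < Real.sqrt (|r| / T) := Real.sqrt_pos.2 (by positivity)
          have h5 := Real.mul_self_sqrt (show 0 ≤ |r| / T by positivity)
          have h6 : |r| = Real.sqrt (|r| / T) * Real.sqrt (|r| / T) * T := by
            rw [h5]; field_simp
          generalize Real.sqrt (|r| / T) = q at *
          rw [h6]
          field_simp
  have hprof : Integrable fun r : ℝ => K * (T⁻¹ * tailProfile |r / T|) :=
    ((integrable_tailProfile_abs.comp_div hT.ne').const_mul _).const_mul _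
  have hDi : Integrable D := by
    refine hprof.mono' ?_ (Eventually.of_forall hbound)
    exact (hH.sub (aestronglyMeasurable_const.indicator hSm)).mul hem.aestronglyMeasurable
  have hDn : ‖∫ r, D r‖ ≤ m * K := by
    refine (norm_integral_le_of_norm_le hprof (Eventually.of_forall hbound)).trans_eq ?_
    rw [integral_const_mul, integral_const_mul,
      Measure.integral_comp_div (fun s : ℝ => tailProfile |s|) T, ← hm, abs_of_pos hT, smul_eq_mul]
    field_simp
  have hDt : Tendsto (fun R : ℝ => ∫ r in {r : ℝ | |r| ≤ R}, D r) atTop (𝓝 (∫ r, D r)) := by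
    simp_rw [setOf_abs_le_eq_Icc]
    exact (aecover_Icc tendsto_neg_atTop_atBot tendsto_id).integral_tendsto_of_countably_generated
      hDi
  refine ⟨(∫ r, D r) + J * L, ?_, ?_⟩
  · calc ‖(∫ r, D r) + J * L‖ ≤ m * K + K * C := by
          refine (norm_add_le _ _).trans ?_
          rw [norm_mul]
          gcongr
      _ = _ := by ring
  · refine (hDt.add (hL.const_mul J)).congr fun R => ?_
    have hi : IntegrableOn (S.indicator e) {r : ℝ | |r| ≤ R} := by
      refine Measure.integrableOn_of_bounded (M := 1 / T) ?_ ?_ ?_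
      · rw [setOf_abs_le_eq_Icc]
        exact measure_Icc_lt_top.ne
      · exact (hem.indicator hSm).aestronglyMeasurable
      · refine Eventually.of_forall fun r => ?_
        by_cases hr : r ∈ S
        · rw [Set.indicator_of_mem hr, hne]
          have : T < |r| := hr
          gcongr
        · rw [Set.indicator_of_notMem hr, norm_zero]
          positivity
    rw [← integral_const_mul, ← integral_add hDi.integrableOn (hi.const_mul J)]
    congr 1
    ext r
    by_cases hr : r ∈ S
    · simp only [hD, Set.indicator_of_mem hr]
      ring
    · simp only [hD, Set.indicator_of_notMem hr]
      ring

/-- If `‖G r‖ ≤ B |r|^{-1/8}` and `G` vanishes for `|r| ≤ 1`, then the integrals of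
`G(r) e^{iyr} / r` over slabs are bounded by a universal multiple of `B`. -/
theorem exists_norm_integral_mul_exp_div_le : ∃ C : ℝ, 0 ≤ C ∧
    ∀ (G : ℝ → ℂ) (B y : ℝ), 0 ≤ B → (∀ r, |r| ≤ 1 → G r = 0) →
    (∀ r, 1 < |r| → ‖G r‖ ≤ B * |r| ^ (-(1 / 8) : ℝ)) → ∀ R : ℝ,
    ‖∫ r in {r : ℝ | |r| ≤ R}, G r * (Complex.exp (Complex.I * (y * r : ℝ)) / r)‖ ≤ C * B := by
  -- `9/8 = 1 + 1/8`: the kernel `1 / |r|` contributes the `1`.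
  set p : ℝ → ℝ := fun s => if s ≤ 1 then 0 else s ^ (-(9 / 8) : ℝ) with hp
  have hp0 : ∀ s, 0 ≤ s → 0 ≤ p s := fun s hs => by
    simp only [hp]
    split_ifs <;> positivity
  have hpi : Integrable fun r : ℝ => p |r| := by
    apply integrable_comp_abs
    rw [← Set.Ioc_union_Ioi_eq_Ioi (zero_le_one (α := ℝ))]
    refine IntegrableOn.union ?_ ?_
    · refine (integrableOn_zero (s := Set.Ioc (0 : ℝ) 1)).congr_fun (fun s hs => ?_)
        measurableSet_Ioc
      simp [hp, hs.2]
    · refine (integrableOn_Ioi_rpow_of_lt (a := -(9 / 8)) (by norm_num) one_pos).congr_fun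
        (fun s hs => ?_) measurableSet_Ioi
      simp [hp, not_le.2 (Set.mem_Ioi.1 hs)]
  refine ⟨∫ r : ℝ, p |r|, integral_nonneg fun r => hp0 _ (abs_nonneg r),
    fun G B y hB h0 h1 R => ?_⟩
  have hpB : Integrable fun r : ℝ => B * p |r| := hpi.const_mul B
  have hb : ∀ r, ‖G r * (Complex.exp (Complex.I * (y * r : ℝ)) / r)‖ ≤ B * p |r| := fun r => by
    rw [norm_mul, norm_div, mul_comm Complex.I, Complex.norm_exp_ofReal_mul_I, Complex.norm_real,
      Real.norm_eq_abs]
    rcases le_or_gt |r| 1 with hr | hr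
    · rw [h0 r hr, norm_zero, zero_mul]
      exact mul_nonneg hB (hp0 _ (abs_nonneg r))
    · have hr0 : 0 < |r| := one_pos.trans hr
      simp only [hp, if_neg (not_le.2 hr)]
      have : |r| ^ (-(9 / 8) : ℝ) = |r| ^ (-(1 / 8) : ℝ) * (1 / |r|) := by
        rw [one_div |r|, ← Real.rpow_neg_one |r|, ← Real.rpow_add hr0]
        norm_num
      rw [this, ← mul_assoc]
      gcongr
      exact h1 r hr
  refine (norm_integral_le_of_norm_le hpB.integrableOn (Eventually.of_forall hb)).trans ?_
  refine (setIntegral_le_integral hpB (Eventually.of_forall fun r =>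
    mul_nonneg hB (hp0 _ (abs_nonneg r)))).trans_eq ?_
  rw [integral_const_mul, mul_comm]

/-! ### Integrals over the hyperplanes `ξ₁ = r` -/

/-- The amplitude and phase at height `r`, with `b` the cutoff and `q` the phase function in the
affine chart `ξ₁ = 1`. -/
def sliceIntegrand {n : ℕ} (b : EuclideanSpace ℝ (Fin n) → ℂ) (a : 𝓢(EuclideanSpace ℝ (Fin n), ℂ))
    (q : EuclideanSpace ℝ (Fin n) → ℝ) (t : ℝ) (y : EuclideanSpace ℝ (Fin n)) (r : ℝ)
    (η : EuclideanSpace ℝ (Fin n)) : ℂ :=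
  b (r⁻¹ • η) * a η *
    Complex.exp (Complex.I * ((inner ℝ y η + t * (r * q (r⁻¹ • η)) : ℝ) : ℂ))

/-- The integral of `sliceIntegrand` over the hyperplane at height `r`. -/
def sliceIntegral {n : ℕ} (b : EuclideanSpace ℝ (Fin n) → ℂ) (a : 𝓢(EuclideanSpace ℝ (Fin n), ℂ))
    (q : EuclideanSpace ℝ (Fin n) → ℝ) (t : ℝ) (y : EuclideanSpace ℝ (Fin n)) (r : ℝ) : ℂ :=
  ∫ η, sliceIntegrand b a q t y r η

section Slice

variable {n : ℕ} {b : EuclideanSpace ℝ (Fin n) → ℂ} {a : 𝓢(EuclideanSpace ℝ (Fin n), ℂ)}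
  {ε : ℝ} {q q₁ q₂ : EuclideanSpace ℝ (Fin n) → ℝ}

theorem hasCompactSupport_of_tsupport_subset_ball
    (hbε : tsupport b ⊆ Metric.ball 0 ε) : HasCompactSupport b :=
  (isCompact_closedBall 0 ε).of_isClosed_subset (isClosed_tsupport b)
    (hbε.trans Metric.ball_subset_closedBall)

theorem exists_cutoff_bounds (hb : ContDiff ℝ 1 b) (hc : HasCompactSupport b) :
    ∃ K : ℝ, 0 ≤ K ∧ (∀ η, ‖b η‖ ≤ K) ∧ (∀ η, ‖b η - b 0‖ ≤ K * ‖η‖) ∧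
      ∀ η, ‖fderiv ℝ b η‖ ≤ K := by
  obtain ⟨K₁, h₁⟩ := hc.exists_bound_of_continuous hb.continuous
  obtain ⟨K₂, h₂⟩ := (hc.fderiv ℝ).exists_bound_of_continuous (hb.continuous_fderiv one_ne_zero)
  obtain ⟨K₃, h₃⟩ := hb.lipschitzWith_of_hasCompactSupport hc one_ne_zero
  have h₁0 : 0 ≤ K₁ := (norm_nonneg _).trans (h₁ 0)
  refine ⟨max K₁ (max K₂ K₃), le_max_of_le_left h₁0, fun η => (h₁ η).trans (le_max_left _ _),
    fun η => ?_, fun η => (h₂ η).trans ((le_max_left _ _).trans (le_max_right _ _))⟩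
  have := h₃.norm_sub_le η 0
  rw [sub_zero] at this
  refine this.trans ?_
  gcongr
  exact (le_max_right _ _).trans (le_max_right _ _)

theorem norm_sliceIntegrand (t : ℝ) (y : EuclideanSpace ℝ (Fin n)) (r : ℝ)
    (η : EuclideanSpace ℝ (Fin n)) :
    ‖sliceIntegrand b a q t y r η‖ = ‖b (r⁻¹ • η)‖ * ‖a η‖ := by
  rw [sliceIntegrand, norm_mul, norm_mul, mul_comm Complex.I, Complex.norm_exp_ofReal_mul_I,
    mul_one]

/-- Where `r⁻¹ • η` leaves the ball, the cutoff is zero, so values of the phase function outside the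
ball never matter. -/
theorem sliceIntegrand_congr (hbε : tsupport b ⊆ Metric.ball 0 ε)
    (hq : ∀ η ∈ Metric.ball 0 ε, q₁ η = q₂ η) (t : ℝ) (y : EuclideanSpace ℝ (Fin n)) (r : ℝ)
    (η : EuclideanSpace ℝ (Fin n)) :
    sliceIntegrand b a q₁ t y r η = sliceIntegrand b a q₂ t y r η := by
  by_cases h : r⁻¹ • η ∈ tsupport b
  · rw [sliceIntegrand, sliceIntegrand, hq _ (hbε h)]
  · simp [sliceIntegrand, image_eq_zero_of_notMem_tsupport h]

theorem measurable_sliceIntegrand (hb : Continuous b) (hbε : tsupport b ⊆ Metric.ball 0 ε)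
    (hq : ContinuousOn q (Metric.ball 0 ε)) (t : ℝ) (y : EuclideanSpace ℝ (Fin n)) :
    Measurable fun p : ℝ × EuclideanSpace ℝ (Fin n) => sliceIntegrand b a q t y p.1 p.2 := by
  classical
  -- Nothing is known about `q` off the ball; extending it by zero makes it measurable everywhere
  -- without changing the integrand.
  set q' := (Metric.ball 0 ε).piecewise q (fun _ => 0) with hq'
  have hm : Measurable q' :=
    hq.measurable_piecewise continuousOn_const Metric.isOpen_ball.measurableSet
  have he : (fun p : ℝ × EuclideanSpace ℝ (Fin n) => sliceIntegrand b a q t y p.1 p.2) =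
      fun p => sliceIntegrand b a q' t y p.1 p.2 := by
    ext p
    refine sliceIntegrand_congr hbε (fun η hη => ?_) t y _ _
    rw [hq', Set.piecewise_eq_of_mem _ _ _ hη]
  rw [he]
  unfold sliceIntegrand
  have h1 : Measurable fun p : ℝ × EuclideanSpace ℝ (Fin n) => p.1⁻¹ • p.2 :=
    measurable_fst.inv.smul measurable_snd
  have h2 : Measurable fun p : ℝ × EuclideanSpace ℝ (Fin n) => inner ℝ y p.2 :=
    (by fun_prop : Continuous fun p : ℝ × EuclideanSpace ℝ (Fin n) => inner ℝ y p.2).measurable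
  refine ((hb.measurable.comp h1).mul (a.continuous.measurable.comp measurable_snd)).mul ?_
  refine Complex.measurable_exp.comp (measurable_const.mul (Complex.measurable_ofReal.comp ?_))
  exact h2.add (measurable_const.mul (measurable_fst.mul (hm.comp h1)))

theorem integrable_sliceIntegrand (hb : Continuous b) (hbε : tsupport b ⊆ Metric.ball 0 ε)
    (hq : ContinuousOn q (Metric.ball 0 ε)) (t : ℝ) (y : EuclideanSpace ℝ (Fin n)) (r : ℝ) :
    Integrable (sliceIntegrand b a q t y r) := by
  obtain ⟨K, hK⟩ :=
    (hasCompactSupport_of_tsupport_subset_ball hbε).exists_bound_of_continuous hb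
  refine (a.integrable (μ := volume)).norm.const_mul K |>.mono' ?_ (Eventually.of_forall fun η => ?_)
  · exact ((measurable_sliceIntegrand hb hbε hq t y).comp measurable_prodMk_left).aestronglyMeasurable
  · rw [norm_sliceIntegrand]
    gcongr
    exact hK _

theorem norm_exp_I_sub_exp_I_le (x y : ℝ) :
    ‖Complex.exp (Complex.I * (x : ℂ)) - Complex.exp (Complex.I * (y : ℂ))‖ ≤ |x - y| := by
  have h : Complex.exp (Complex.I * (x : ℂ)) - Complex.exp (Complex.I * (y : ℂ)) =
      Complex.exp (Complex.I * (y : ℂ)) * (Complex.exp (Complex.I * ((x - y : ℝ) : ℂ)) - 1) := by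
    rw [mul_sub, ← Complex.exp_add, mul_one]
    congr 2
    push_cast
    ring
  rw [h, norm_mul, mul_comm Complex.I (y : ℂ), Complex.norm_exp_ofReal_mul_I, one_mul]
  exact Real.norm_exp_I_mul_ofReal_sub_one_le

/-- Two phases that agree to order `k` give nearby slice integrals. -/
theorem exists_norm_sliceIntegral_sub_le (hb : ContDiff ℝ 1 b)
    (hbε : tsupport b ⊆ Metric.ball 0 ε) (hq₁ : ContinuousOn q₁ (Metric.ball 0 ε))
    (hq₂ : ContinuousOn q₂ (Metric.ball 0 ε)) (k : ℕ) {C : ℝ} (hC : 0 ≤ C)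
    (hq : ∀ η ∈ Metric.ball 0 ε, |q₁ η - q₂ η| ≤ C * ‖η‖ ^ k) :
    ∃ K : ℝ, 0 ≤ K ∧ ∀ t y r, r ≠ 0 →
      ‖sliceIntegral b a q₁ t y r - sliceIntegral b a q₂ t y r‖ ≤ K * (|t| * |r| / |r| ^ k) := by
  obtain ⟨B, hB, hB1, -, -⟩ := exists_cutoff_bounds hb (hasCompactSupport_of_tsupport_subset_ball hbε)
  have hI0 : 0 ≤ ∫ η, ‖η‖ ^ k * ‖a η‖ := integral_nonneg fun η => by positivity
  refine ⟨B * C * ∫ η, ‖η‖ ^ k * ‖a η‖, by positivity, fun t y r hr => ?_⟩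
  have hr' : 0 < |r| := abs_pos.2 hr
  rw [sliceIntegral, sliceIntegral, ← integral_sub
    (integrable_sliceIntegrand hb.continuous hbε hq₁ t y r)
    (integrable_sliceIntegrand hb.continuous hbε hq₂ t y r)]
  refine (norm_integral_le_of_norm_le
    ((a.integrable_pow_mul volume k).const_mul (B * C * (|t| * |r| / |r| ^ k)))
    (Eventually.of_forall fun η => ?_)).trans_eq ?_
  · by_cases h : r⁻¹ • η ∈ tsupport b
    · rw [sliceIntegrand, sliceIntegrand, ← mul_sub, norm_mul, norm_mul]
      have h1 := norm_exp_I_sub_exp_I_le (inner ℝ y η + t * (r * q₁ (r⁻¹ • η)))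
        (inner ℝ y η + t * (r * q₂ (r⁻¹ • η)))
      have h2 : inner ℝ y η + t * (r * q₁ (r⁻¹ • η)) - (inner ℝ y η + t * (r * q₂ (r⁻¹ • η))) =
          t * r * (q₁ (r⁻¹ • η) - q₂ (r⁻¹ • η)) := by ring
      rw [h2, abs_mul, abs_mul] at h1
      have h3 := hq _ (hbε h)
      rw [norm_smul, norm_inv, Real.norm_eq_abs] at h3
      calc _ ≤ B * ‖a η‖ * (|t| * |r| * (C * (|r|⁻¹ * ‖η‖) ^ k)) := by
            gcongr
            · exact hB1 _
            · exact h1.trans (by gcongr)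
        _ = _ := by rw [mul_pow, inv_pow]; ring
    · simp only [sliceIntegrand, image_eq_zero_of_notMem_tsupport h, zero_mul, sub_zero, norm_zero]
      positivity
  · rw [integral_const_mul]
    ring

/-- Far out the cutoff is nearly constant on slices. -/
theorem exists_norm_sliceIntegral_zero_sub_le (hb : ContDiff ℝ 1 b)
    (hbε : tsupport b ⊆ Metric.ball 0 ε) :
    ∃ K : ℝ, 0 ≤ K ∧ ∀ t y r, r ≠ 0 →
      ‖sliceIntegral b a (fun _ => 0) t y r - sliceIntegral (fun _ => b 0) a (fun _ => 0) 0 y 1‖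
        ≤ K / |r| := by
  obtain ⟨B, hB, hB1, hB2, -⟩ :=
    exists_cutoff_bounds hb (hasCompactSupport_of_tsupport_subset_ball hbε)
  have hI0 : 0 ≤ ∫ η, ‖η‖ ^ 1 * ‖a η‖ := integral_nonneg fun η => by positivity
  refine ⟨B * ∫ η, ‖η‖ ^ 1 * ‖a η‖, by positivity, fun t y r hr => ?_⟩
  have hr' : 0 < |r| := abs_pos.2 hr
  -- The constant cutoff `b 0` need not have compact support, so integrability comes from `a` alone.
  have hi : Integrable (sliceIntegrand (fun _ => b 0) a (fun _ => 0) 0 y 1) := by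
    refine ((a.integrable (μ := volume)).norm.const_mul ‖b 0‖).mono' ?_
      (Eventually.of_forall fun η => (norm_sliceIntegrand _ _ _ _).le)
    refine Continuous.aestronglyMeasurable ?_
    unfold sliceIntegrand
    have := a.continuous
    fun_prop
  rw [sliceIntegral, sliceIntegral, ← integral_sub
    (integrable_sliceIntegrand hb.continuous hbε continuousOn_const t y r) hi]
  refine (norm_integral_le_of_norm_le
    ((a.integrable_pow_mul volume 1).const_mul (B / |r|))
    (Eventually.of_forall fun η => ?_)).trans_eq ?_
  · have h1 : sliceIntegrand b a (fun _ => 0) t y r η -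
        sliceIntegrand (fun _ => b 0) a (fun _ => 0) 0 y 1 η =
        (b (r⁻¹ • η) - b 0) * (a η * Complex.exp (Complex.I * ((inner ℝ y η : ℝ) : ℂ))) := by
      simp only [sliceIntegrand, mul_zero, add_zero]
      ring
    rw [h1, norm_mul, norm_mul, mul_comm Complex.I, Complex.norm_exp_ofReal_mul_I, mul_one]
    have h2 := hB2 (r⁻¹ • η)
    rw [norm_smul, norm_inv, Real.norm_eq_abs] at h2
    calc _ ≤ B * (|r|⁻¹ * ‖η‖) * ‖a η‖ := by gcongr
      _ = _ := by rw [pow_one]; ring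
  · rw [integral_const_mul]
    ring

theorem exists_norm_sliceIntegral_le (hb : Continuous b) (hc : HasCompactSupport b) :
    ∃ K : ℝ, 0 ≤ K ∧ (∀ q t y r, ‖sliceIntegral b a q t y r‖ ≤ K) ∧
      ∀ q t y r, ‖sliceIntegral (fun _ => b 0) a q t y r‖ ≤ K := by
  obtain ⟨B, hB⟩ := hc.exists_bound_of_continuous hb
  have hB0 : 0 ≤ B := (norm_nonneg _).trans (hB 0)
  have hI0 : 0 ≤ ∫ η, ‖a η‖ := integral_nonneg fun η => norm_nonneg _
  refine ⟨B * ∫ η, ‖a η‖, by positivity, fun q t y r => ?_, fun q t y r => ?_⟩ <;>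
  · rw [sliceIntegral, ← integral_const_mul]
    refine norm_integral_le_of_norm_le ((a.integrable (μ := volume)).norm.const_mul B)
      (Eventually.of_forall fun η => ?_)
    rw [norm_sliceIntegrand]
    gcongr
    exact hB _

/-- Decay of the slice integrals when the phase is convex or concave in one direction. -/
theorem exists_norm_sliceIntegral_le_sqrt (hb : ContDiff ℝ 1 b)
    (hbε : tsupport b ⊆ Metric.ball 0 ε) (hq : ContDiffOn ℝ 2 q (Metric.ball 0 ε))
    {w : EuclideanSpace ℝ (Fin n)} (hw : w ≠ 0) {c σ : ℝ} (hc : 0 < c) (hσ : |σ| = 1)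
    (hqw : ∀ η ∈ Metric.ball 0 ε, c ≤ σ * fderiv ℝ (fun ζ => fderiv ℝ q ζ w) η w) :
    ∃ K : ℝ, 0 ≤ K ∧ ∀ t y r, t ≠ 0 → 1 ≤ |r| →
      ‖sliceIntegral b a q t y r‖ ≤ K * Real.sqrt (|r| / |t|) := by
  obtain ⟨B, hB, hB1, -, hB3⟩ :=
    exists_cutoff_bounds hb (hasCompactSupport_of_tsupport_subset_ball hbε)
  set a' := SchwartzMap.fderivCLM ℝ (EuclideanSpace ℝ (Fin n)) ℂ a with ha'
  have ha'i : Integrable fun η => ‖fderiv ℝ a η‖ := (a'.integrable (μ := volume)).norm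
  have hai : Integrable fun η => ‖a η‖ := (a.integrable (μ := volume)).norm
  set I : ℝ := ∫ η, (‖a η‖ + ‖fderiv ℝ a η‖) with hI
  have hI0 : 0 ≤ I := integral_nonneg fun η => by positivity
  refine ⟨9 * (B * ‖w‖ * I) / Real.sqrt c, by positivity, fun t y r ht hr1 => ?_⟩
  have hr' : 0 < |r| := one_pos.trans_le hr1
  have hr : r ≠ 0 := abs_pos.1 hr'
  have ht' : 0 < |t| := abs_pos.2 ht
  have hopen : IsOpen (Metric.ball (0 : EuclideanSpace ℝ (Fin n)) ε) := Metric.isOpen_ball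
  -- The rescaled ball on which the phase is regular; its convexity makes every line meet it in an
  -- interval.
  set U : Set (EuclideanSpace ℝ (Fin n)) := (fun η => r⁻¹ • η) ⁻¹' Metric.ball 0 ε with hU
  have hsm : Continuous fun η : EuclideanSpace ℝ (Fin n) => r⁻¹ • η := continuous_const_smul _
  have hUo : IsOpen U := hopen.preimage hsm
  have hUc : Convex ℝ U := (convex_ball _ _).smul_preimage r⁻¹
  set g : EuclideanSpace ℝ (Fin n) → ℂ := fun η => b (r⁻¹ • η) * a η with hg
  have hbr : ContDiff ℝ 1 fun η => b (r⁻¹ • η) := hb.comp (contDiff_const_smul _)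
  have had : ContDiff ℝ 1 a := a.smooth 1
  have hgd : ContDiff ℝ 1 g := hbr.mul had
  have hts : tsupport g ⊆ (fun η => r⁻¹ • η) ⁻¹' tsupport b :=
    (tsupport_mul_subset_left (f := fun η => b (r⁻¹ • η))).trans
      (tsupport_comp_subset_preimage b hsm)
  have hgU : tsupport g ⊆ U := hts.trans (Set.preimage_mono hbε)
  have hgc : HasCompactSupport g := by
    have h1 : HasCompactSupport fun η => b (r⁻¹ • η) :=
      (hasCompactSupport_of_tsupport_subset_ball hbε).comp_smul (inv_ne_zero hr)
    exact h1.mul_right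
  have hqd : ∀ η ∈ U, HasFDerivAt q (fderiv ℝ q (r⁻¹ • η)) (r⁻¹ • η) := fun η hη =>
    ((hq.contDiffAt (hopen.mem_nhds hη)).differentiableAt two_ne_zero).hasFDerivAt
  have hq' : ContDiffOn ℝ 1 (fun ζ => fderiv ℝ q ζ w) (Metric.ball 0 ε) :=
    (hq.fderiv_of_isOpen hopen (m := 1) (by norm_num)).clm_apply contDiffOn_const
  have hq'd : ∀ η ∈ U, HasFDerivAt (fun ζ => fderiv ℝ q ζ w)
      (fderiv ℝ (fun ζ => fderiv ℝ q ζ w) (r⁻¹ • η)) (r⁻¹ • η) := fun η hη =>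
    ((hq'.contDiffAt (hopen.mem_nhds hη)).differentiableAt one_ne_zero).hasFDerivAt
  have hq'' : ContinuousOn (fun η => fderiv ℝ (fun ζ => fderiv ℝ q ζ w) η w) (Metric.ball 0 ε) :=
    (hq'.continuousOn_fderiv_of_isOpen hopen le_rfl).clm_apply continuousOn_const
  have hsd : ∀ η, HasFDerivAt (fun η : EuclideanSpace ℝ (Fin n) => r⁻¹ • η)
      (r⁻¹ • ContinuousLinearMap.id ℝ (EuclideanSpace ℝ (Fin n))) η := fun η =>
    (hasFDerivAt_id η).const_smul r⁻¹
  -- Two derivatives of `t r q(η / r)` along `w` produce `(t / r) q''`, at least `c |t| / |r|` in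
  -- absolute value. The sign `s` of `t / r` is combined with `σ`.
  set κ : ℝ := Real.sqrt (c * (|t| / |r|)) with hκ
  have hκ0 : 0 < κ := Real.sqrt_pos.2 (by positivity)
  set s : ℝ := (t * r⁻¹) / |t * r⁻¹| with hs
  have htr : 0 < |t * r⁻¹| := abs_pos.2 (mul_ne_zero ht (inv_ne_zero hr))
  have hs1 : |s| = 1 := by rw [hs, abs_div, abs_abs, div_self htr.ne']
  have hss : s * (t * r⁻¹) = |t| / |r| := by
    rw [hs, div_mul_eq_mul_div, ← pow_two, ← sq_abs, pow_two, mul_div_assoc, div_self htr.ne',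
      mul_one, abs_mul, abs_inv, div_eq_mul_inv]
  have key := norm_integral_mul_exp_le_of_lineDeriv volume hw hUo hUc hgd hgc hgU
    (h := fun η => inner ℝ y η + t * (r * q (r⁻¹ • η)))
    (h₁ := fun η => inner ℝ y w + t * fderiv ℝ q (r⁻¹ • η) w)
    (h₂ := fun η => t * r⁻¹ * fderiv ℝ (fun ζ => fderiv ℝ q ζ w) (r⁻¹ • η) w)
    hκ0 (σ := s * σ) (by rw [abs_mul, hs1, hσ, mul_one]) ?_ ?_ ?_ ?_ ?_
  · have hgi : ∫ η, ‖fderiv ℝ g η w‖ ≤ B * ‖w‖ * I := by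
      rw [hI, ← integral_const_mul]
      refine integral_mono_of_nonneg (Eventually.of_forall fun _ => norm_nonneg _)
        ((hai.add ha'i).const_mul _) (Eventually.of_forall fun η => ?_)
      have h1 : HasFDerivAt (fun η => b (r⁻¹ • η)) ((fderiv ℝ b (r⁻¹ • η)).comp
          (r⁻¹ • ContinuousLinearMap.id ℝ (EuclideanSpace ℝ (Fin n)))) η :=
        ((hb.differentiable one_ne_zero) _).hasFDerivAt.comp η (hsd η)
      have h2 : HasFDerivAt a (fderiv ℝ a η) η :=
        ((had.differentiable one_ne_zero) η).hasFDerivAt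
      have h3 : fderiv ℝ g η w = b (r⁻¹ • η) * fderiv ℝ a η w +
          a η * ((r⁻¹ : ℝ) • fderiv ℝ b (r⁻¹ • η) w) := by
        have h5 : HasFDerivAt g _ η := h1.mul h2
        rw [h5.fderiv]
        simp
      -- Here `1 ≤ |r|` is used: differentiating `b(η / r)` costs a factor `|r|⁻¹`, so the amplitude
      -- bound is uniform in `r`.
      have h4 : |r|⁻¹ ≤ 1 := inv_le_one_of_one_le₀ hr1
      simp only
      rw [h3]
      calc _ ≤ ‖b (r⁻¹ • η)‖ * (‖fderiv ℝ a η‖ * ‖w‖) +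
            ‖a η‖ * (|r|⁻¹ * (‖fderiv ℝ b (r⁻¹ • η)‖ * ‖w‖)) := by
            refine (norm_add_le _ _).trans ?_
            rw [norm_mul, norm_mul, norm_smul, norm_inv, Real.norm_eq_abs]
            gcongr <;> exact ContinuousLinearMap.le_opNorm _ _
        _ ≤ B * (‖fderiv ℝ a η‖ * ‖w‖) + ‖a η‖ * (1 * (B * ‖w‖)) := by
            gcongr
            · exact hB1 _
            · exact hB3 _
        _ = _ := by ring
    have hκe : κ = Real.sqrt c * Real.sqrt (|t| / |r|) := by
      rw [hκ, Real.sqrt_mul hc.le]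
    have hinv : Real.sqrt (|r| / |t|) = (Real.sqrt (|t| / |r|))⁻¹ := by
      rw [← Real.sqrt_inv, inv_div]
    refine key.trans ?_
    calc 9 / κ * ∫ η, ‖fderiv ℝ g η w‖ ≤ 9 / κ * (B * ‖w‖ * I) := by gcongr
      _ = _ := by
        rw [hκe, hinv]
        have : 0 < Real.sqrt (|t| / |r|) := Real.sqrt_pos.2 (by positivity)
        have : 0 < Real.sqrt c := Real.sqrt_pos.2 hc
        field_simp
  · refine ContinuousOn.add (by fun_prop) (continuousOn_const.mul (continuousOn_const.mul ?_))
    exact hq.continuousOn.comp hsm.continuousOn fun η hη => hη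
  · intro η hη
    have h1 : HasFDerivAt (fun η => q (r⁻¹ • η)) _ η := (hqd η hη).comp η (hsd η)
    have h2 : HasFDerivAt (fun η => inner ℝ y η) (innerSL ℝ y) η := (innerSL ℝ y).hasFDerivAt
    have h3 : HasFDerivAt (fun η => inner ℝ y η + t * (r * q (r⁻¹ • η))) _ η :=
      h2.add ((h1.const_mul r).const_mul t)
    convert h3.hasLineDerivAt w using 1
    change _ = inner ℝ y w + t * (r * fderiv ℝ q (r⁻¹ • η) (r⁻¹ • w))
    rw [map_smul, smul_eq_mul, ← mul_assoc r, mul_inv_cancel₀ hr, one_mul]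
  · intro η hη
    have h1 : HasFDerivAt (fun η => fderiv ℝ q (r⁻¹ • η) w) _ η := (hq'd η hη).comp η (hsd η)
    convert (((h1.const_mul t).const_add (inner ℝ y w)).hasLineDerivAt w) using 1
    change _ = t * fderiv ℝ (fun ζ => fderiv ℝ q ζ w) (r⁻¹ • η) (r⁻¹ • w)
    rw [map_smul, smul_eq_mul]
    ring
  · exact continuousOn_const.mul (hq''.comp hsm.continuousOn fun η hη => hη)
  · intro η hη
    rw [hκ, Real.sq_sqrt (by positivity)]
    have h1 := hqw _ hη
    calc c * (|t| / |r|) ≤ (σ * fderiv ℝ (fun ζ => fderiv ℝ q ζ w) (r⁻¹ • η) w) * (|t| / |r|) := by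
          gcongr
      _ = _ := by rw [← hss]; ring

end Slice

/-! ### Existence, boundedness and comparison of the reduced principal values -/

section PrincipalValue

variable {n : ℕ} {b : EuclideanSpace ℝ (Fin n) → ℂ} {a : 𝓢(EuclideanSpace ℝ (Fin n), ℂ)}
  {φ : ℝ → ℝ} {ε : ℝ} {q q₁ q₂ : EuclideanSpace ℝ (Fin n) → ℝ}

theorem IsCutoff.exists_bound (hφ : IsCutoff φ) : ∃ K : ℝ, 1 ≤ K ∧ ∀ r, |φ r| ≤ K := by
  obtain ⟨K, hK⟩ := (isCompact_Icc (a := (-2 : ℝ)) (b := 2)).exists_bound_of_continuousOn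
    hφ.smooth.continuous.continuousOn
  refine ⟨max K 1, le_max_right _ _, fun r => ?_⟩
  rcases le_or_gt |r| 2 with h | h
  · exact (hK r (abs_le.1 h)).trans (le_max_left _ _)
  · rw [hφ.eq_one r h, abs_one]
    exact le_max_right _ _

/-- The integral over a slab, reduced to one dimension. -/
def slabIntegral {n : ℕ} (b : EuclideanSpace ℝ (Fin n) → ℂ) (φ : ℝ → ℝ)
    (a : 𝓢(EuclideanSpace ℝ (Fin n), ℂ)) (q : EuclideanSpace ℝ (Fin n) → ℝ) (t : ℝ)
    (y : EuclideanSpace ℝ (Fin n)) (s R : ℝ) : ℂ :=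
  ∫ r in {r : ℝ | |r| ≤ R}, (φ r : ℂ) * sliceIntegral b a q t y r *
    (Complex.exp (Complex.I * (s * r : ℝ)) / r)

/-- Decay of slice integrals, uniformly in the linear part of the phase. -/
def HasSliceDecay {n : ℕ} (b : EuclideanSpace ℝ (Fin n) → ℂ)
    (a : 𝓢(EuclideanSpace ℝ (Fin n), ℂ)) (q : EuclideanSpace ℝ (Fin n) → ℝ) : Prop :=
  ∃ K : ℝ, 0 ≤ K ∧ ∀ t y r, t ≠ 0 → 1 ≤ |r| →
    ‖sliceIntegral b a q t y r‖ ≤ K * Real.sqrt (|r| / |t|)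

theorem aestronglyMeasurable_sliceIntegral (hb : Continuous b)
    (hbε : tsupport b ⊆ Metric.ball 0 ε) (hq : ContinuousOn q (Metric.ball 0 ε)) (t : ℝ)
    (y : EuclideanSpace ℝ (Fin n)) :
    AEStronglyMeasurable (fun r => sliceIntegral b a q t y r) volume :=
  (measurable_sliceIntegrand hb hbε hq t y).aestronglyMeasurable (μ := volume.prod volume)
    |>.integral_prod_right'

/-- Existence and uniform boundedness of the one-dimensional principal values. -/
theorem exists_tendsto_slabIntegral (hφ : IsCutoff φ) (hb : ContDiff ℝ 1 b)
    (hbε : tsupport b ⊆ Metric.ball 0 ε) (hq : ContinuousOn q (Metric.ball 0 ε)) {C : ℝ}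
    (hC : 0 ≤ C) (hq2 : ∀ η ∈ Metric.ball 0 ε, |q η| ≤ C * ‖η‖ ^ 2)
    (hdec : HasSliceDecay b a q ∨ ∀ η ∈ Metric.ball 0 ε, q η = 0) :
    ∃ B : ℝ, ∀ t y s, ∃ u : ℂ, ‖u‖ ≤ B ∧
      Tendsto (fun R => slabIntegral b φ a q t y s R) atTop (𝓝 u) := by
  obtain ⟨P, hP1, hP⟩ := hφ.exists_bound
  have hP0 : 0 ≤ P := zero_le_one.trans hP1
  obtain ⟨K₁, hK₁0, hK₁⟩ := exists_norm_sliceIntegral_sub_le (a := a) hb hbε hq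
    (q₂ := fun _ => 0) continuousOn_const 2 hC (by simpa using hq2)
  obtain ⟨K₂, hK₂0, hK₂⟩ := exists_norm_sliceIntegral_zero_sub_le (a := a) hb hbε
  obtain ⟨K₃, hK₃0, -, hK₃⟩ := exists_norm_sliceIntegral_le (a := a) hb.continuous
    (hasCompactSupport_of_tsupport_subset_ball hbε)
  obtain ⟨Z, hZ0, hZ⟩ := exists_tendsto_integral_mul_exp_div
  set J : EuclideanSpace ℝ (Fin n) → ℂ :=
    fun y => sliceIntegral (fun _ => b 0) a (fun _ => 0) 0 y 1 with hJ
  have hmeas : ∀ t y, AEStronglyMeasurable (fun r => (φ r : ℂ) * sliceIntegral b a q t y r)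
      volume := fun t y =>
    (Complex.continuous_ofReal.comp hφ.smooth.continuous).aestronglyMeasurable.mul
      (aestronglyMeasurable_sliceIntegral hb.continuous hbε hq t y)
  -- Three errors of size `1 / |r|` are collected: replacing `q` by `0` (through `A`), replacing the
  -- cutoff by its value at `0`, and replacing `φ` by `1`, which costs nothing beyond `|r| = 2`.
  have hfar : ∀ (A : ℝ) t y, 0 ≤ A →
      (∀ r, 1 < |r| → ‖sliceIntegral b a q t y r - sliceIntegral b a (fun _ => 0) t y r‖
        ≤ A / |r|) →
      ∀ r, 1 < |r| → ‖(φ r : ℂ) * sliceIntegral b a q t y r - J y‖ ≤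
        (P * (A + K₂) + 2 * (P + 1) * K₃) / |r| := by
    intro A t y hA h r hr
    have hr0 : 0 < |r| := one_pos.trans hr
    have h1 := h r hr
    have h2 := hK₂ t y r (abs_pos.1 hr0)
    have h3 : ‖((φ r : ℂ) - 1)‖ ≤ 2 * (P + 1) / |r| := by
      rcases le_or_gt |r| 2 with hr2 | hr2
      · rw [le_div_iff₀ hr0]
        have : ‖((φ r : ℂ) - 1)‖ ≤ P + 1 := by
          refine (norm_sub_le _ _).trans ?_
          rw [Complex.norm_real, norm_one]
          gcongr
          exact hP r
        calc _ ≤ (P + 1) * 2 := by gcongr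
          _ = _ := by ring
      · rw [hφ.eq_one r hr2, Complex.ofReal_one, sub_self, norm_zero]
        positivity
    have h4 : (φ r : ℂ) * sliceIntegral b a q t y r - J y =
        (φ r : ℂ) * ((sliceIntegral b a q t y r - sliceIntegral b a (fun _ => 0) t y r) +
          (sliceIntegral b a (fun _ => 0) t y r - J y)) + ((φ r : ℂ) - 1) * J y := by ring
    rw [h4]
    refine (norm_add_le _ _).trans ?_
    rw [norm_mul, norm_mul, Complex.norm_real]
    calc _ ≤ P * (A / |r| + K₂ / |r|) + 2 * (P + 1) / |r| * K₃ := by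
          gcongr
          · exact hP r
          · exact (norm_add_le _ _).trans (add_le_add h1 h2)
          · exact hK₃ _ _ _ _
      _ = _ := by ring
  have hφ0 : ∀ r, |r| ≤ 1 → φ r = 0 := hφ.eq_zero
  rcases hdec with ⟨K₄, hK₄0, hK₄⟩ | hzero
  · set K : ℝ := P * (K₁ + K₂) + 2 * (P + 1) * K₃ + P * K₄ + K₃ with hK
    refine ⟨Z * K, fun t y s => ?_⟩
    -- The transition scale is `|t|`, but not below `1`: if `|r| ≤ T` then either `φ r = 0`, or `T =
    -- |t| > 1` and the van der Corput decay applies.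
    set T : ℝ := max 1 |t| with hT
    have hT1 : 1 ≤ T := le_max_left _ _
    have hT0 : 0 < T := one_pos.trans_le hT1
    refine hZ _ (J y) K T s hT0 (hmeas t y) ?_ ?_ ?_
    · intro r hr
      rcases le_or_gt |r| 1 with hr1 | hr1
      · rw [hφ0 r hr1, Complex.ofReal_zero, zero_mul, norm_zero]
        positivity
      · have ht : 1 < |t| := by
          rcases le_or_gt |t| 1 with h | h
          · rw [hT, max_eq_left h] at hr
            linarith
          · exact h
        rw [hT, max_eq_right ht.le, norm_mul, Complex.norm_real]
        calc _ ≤ P * (K₄ * Real.sqrt (|r| / |t|)) := by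
              gcongr
              · exact hP r
              · exact hK₄ t y r (abs_pos.1 (one_pos.trans ht)) hr1.le
          _ = P * K₄ * Real.sqrt (|r| / |t|) := by ring
          _ ≤ _ := by
              gcongr
              rw [hK]
              have : 0 ≤ P * (K₁ + K₂) + 2 * (P + 1) * K₃ := by positivity
              linarith
    · intro r hr
      have hr1 : 1 < |r| := hT1.trans_lt hr
      have hr0 : 0 < |r| := one_pos.trans hr1
      have h1 := hfar (K₁ * |t|) t y (by positivity) (fun r hr => by
        have hr0 : 0 < |r| := one_pos.trans hr
        refine (hK₁ t y r (abs_pos.1 hr0)).trans_eq ?_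
        field_simp) r hr1
      refine h1.trans ?_
      rw [← mul_div_assoc]
      gcongr
      have h2 : |t| ≤ T := le_max_right _ _
      calc P * (K₁ * |t| + K₂) + 2 * (P + 1) * K₃
          ≤ P * (K₁ * T + K₂ * T) + 2 * (P + 1) * K₃ * T := by
            refine add_le_add (mul_le_mul_of_nonneg_left (add_le_add ?_ ?_) hP0) ?_
            · gcongr
            · exact le_mul_of_one_le_right hK₂0 hT1
            · exact le_mul_of_one_le_right (by positivity) hT1
        _ = (P * (K₁ + K₂) + 2 * (P + 1) * K₃) * T := by ring
        _ ≤ K * T := by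
            gcongr
            rw [hK]
            have : 0 ≤ P * K₄ := by positivity
            linarith
    · refine (hK₃ _ _ _ _).trans ?_
      rw [hK]
      have : 0 ≤ P * (K₁ + K₂) + 2 * (P + 1) * K₃ + P * K₄ := by positivity
      linarith
  -- Without a curved phase, `A = 0` in `hfar`; the scale `T = 1` works for all `t`, and no decay
  -- estimate is needed.
  · set K : ℝ := P * (0 + K₂) + 2 * (P + 1) * K₃ + K₃ with hK
    refine ⟨Z * K, fun t y s => ?_⟩
    refine hZ _ (J y) K 1 s one_pos (hmeas t y) ?_ ?_ ?_
    · intro r hr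
      rw [hφ0 r hr, Complex.ofReal_zero, zero_mul, norm_zero]
      positivity
    · intro r hr
      have hr0 : 0 < |r| := one_pos.trans hr
      refine (hfar 0 t y le_rfl (fun r _ => ?_) r hr).trans ?_
      · have : sliceIntegral b a q t y r = sliceIntegral b a (fun _ => 0) t y r := by
          unfold sliceIntegral
          congr 1
          ext η
          exact sliceIntegrand_congr hbε hzero t y r η
        rw [this, sub_self, norm_zero, zero_div]
      · rw [mul_one_div]
        gcongr
        rw [hK]
        linarith
    · refine (hK₃ _ _ _ _).trans ?_
      rw [hK]
      have : 0 ≤ P * (0 + K₂) + 2 * (P + 1) * K₃ := by positivity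
      linarith

/-- The singularity of `1 / r` is harmless because `φ` vanishes on `|r| ≤ 1`; on a slab the
integrand is bounded. -/
theorem integrableOn_slab (hφ : IsCutoff φ) (hb : ContDiff ℝ 1 b)
    (hbε : tsupport b ⊆ Metric.ball 0 ε) (hq : ContinuousOn q (Metric.ball 0 ε)) (t : ℝ)
    (y : EuclideanSpace ℝ (Fin n)) (s R : ℝ) :
    IntegrableOn (fun r : ℝ => (φ r : ℂ) * sliceIntegral b a q t y r *
      (Complex.exp (Complex.I * (s * r : ℝ)) / r)) {r : ℝ | |r| ≤ R} := by
  obtain ⟨P, hP1, hP⟩ := hφ.exists_bound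
  obtain ⟨K, hK0, hK, -⟩ := exists_norm_sliceIntegral_le (a := a) hb.continuous
    (hasCompactSupport_of_tsupport_subset_ball hbε)
  refine Measure.integrableOn_of_bounded (M := P * K) ?_ ?_ ?_
  · rw [setOf_abs_le_eq_Icc]
    exact measure_Icc_lt_top.ne
  · refine AEStronglyMeasurable.mul
      ((Complex.continuous_ofReal.comp hφ.smooth.continuous).aestronglyMeasurable.mul
        (aestronglyMeasurable_sliceIntegral hb.continuous hbε hq t y)) ?_
    refine (Measurable.div ?_ (by fun_prop)).aestronglyMeasurable
    exact Continuous.measurable (by fun_prop)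
  · refine Eventually.of_forall fun r => ?_
    have hPK : 0 ≤ P * K := mul_nonneg (zero_le_one.trans hP1) hK0
    rcases le_or_gt |r| 1 with hr | hr
    · simpa [hφ.eq_zero r hr] using hPK
    · rw [norm_mul, norm_mul, norm_div, mul_comm Complex.I, Complex.norm_exp_ofReal_mul_I,
        Complex.norm_real, Complex.norm_real, Real.norm_eq_abs, Real.norm_eq_abs]
      have h1 : 1 / |r| ≤ 1 := by
        rw [div_le_one (one_pos.trans hr)]
        exact hr.le
      calc |φ r| * ‖sliceIntegral b a q t y r‖ * (1 / |r|) ≤ P * K * 1 := by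
            gcongr
            · exact hP r
            · exact hK _ _ _ _
        _ = _ := mul_one _

/-- Comparison of the principal values for two phases with a common second order jet. -/
theorem exists_rpow_mul_norm_sub_le (hφ : IsCutoff φ) (hb : ContDiff ℝ 1 b)
    (hbε : tsupport b ⊆ Metric.ball 0 ε) (hq₁ : ContinuousOn q₁ (Metric.ball 0 ε))
    (hq₂ : ContinuousOn q₂ (Metric.ball 0 ε)) {C : ℝ} (hC : 0 ≤ C)
    (hq : ∀ η ∈ Metric.ball 0 ε, |q₁ η - q₂ η| ≤ C * ‖η‖ ^ 3)
    (hd₁ : HasSliceDecay b a q₁) (hd₂ : HasSliceDecay b a q₂) :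
    ∃ B : ℝ, ∀ t y s u₁ u₂,
      Tendsto (fun R => slabIntegral b φ a q₁ t y s R) atTop (𝓝 u₁) →
      Tendsto (fun R => slabIntegral b φ a q₂ t y s R) atTop (𝓝 u₂) →
      |t| ^ (1 / 8 : ℝ) * ‖u₁ - u₂‖ ≤ B := by
  obtain ⟨P, hP1, hP⟩ := hφ.exists_bound
  have hP0 : 0 ≤ P := zero_le_one.trans hP1
  obtain ⟨K, hK0, hK⟩ := exists_norm_sliceIntegral_sub_le (a := a) hb hbε hq₁ hq₂ 3 hC hq
  obtain ⟨K₁, hK₁0, hK₁⟩ := hd₁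
  obtain ⟨K₂, hK₂0, hK₂⟩ := hd₂
  obtain ⟨Z, hZ0, hZ⟩ := exists_norm_integral_mul_exp_div_le
  set M : ℝ := max K (K₁ + K₂) with hM
  have hM0 : 0 ≤ M := le_max_of_le_left hK0
  refine ⟨Z * (P * M), fun t y s u₁ u₂ h₁ h₂ => ?_⟩
  -- The decay estimate excludes `t = 0`, where the weight `|t| ^ (1/8)` vanishes.
  rcases eq_or_ne t 0 with rfl | ht
  · rw [abs_zero, Real.zero_rpow (by norm_num), zero_mul]
    positivity
  have ht0 : 0 < |t| := abs_pos.2 ht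
  -- Interpolation of `e1` and `e2` with weights `θ` and `1 - θ`. Negative powers of both `|t|` and
  -- `|r|` require `2/3 < θ < 4/5`; the choice `θ = 3/4` makes both exponents `-1/8`.
  have hdiff : ∀ r, 1 < |r| → ‖sliceIntegral b a q₁ t y r - sliceIntegral b a q₂ t y r‖ ≤
      M * |t| ^ (-(1 / 8) : ℝ) * |r| ^ (-(1 / 8) : ℝ) := by
    intro r hr
    have hr0 : 0 < |r| := one_pos.trans hr
    set D := ‖sliceIntegral b a q₁ t y r - sliceIntegral b a q₂ t y r‖ with hD
    have hD0 : 0 ≤ D := norm_nonneg _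
    have e1 : D ≤ M * (|r| / |t|) ^ (1 / 2 : ℝ) := by
      rw [← Real.sqrt_eq_rpow]
      calc D ≤ K₁ * Real.sqrt (|r| / |t|) + K₂ * Real.sqrt (|r| / |t|) :=
            (norm_sub_le _ _).trans (add_le_add (hK₁ t y r ht hr.le) (hK₂ t y r ht hr.le))
        _ = (K₁ + K₂) * Real.sqrt (|r| / |t|) := by ring
        _ ≤ _ := by
          gcongr
          exact le_max_right _ _
    have e2 : D ≤ M * (|t| / |r| ^ 2) := by
      calc D ≤ K * (|t| * |r| / |r| ^ 3) := hK t y r (abs_pos.1 hr0)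
        _ = K * (|t| / |r| ^ 2) := by field_simp
        _ ≤ _ := by
          gcongr
          exact le_max_left _ _
    have f1 : ((|r| / |t|) ^ (1 / 2 : ℝ)) ^ (3 / 4 : ℝ) =
        |r| ^ (3 / 8 : ℝ) * |t| ^ (-(3 / 8) : ℝ) := by
      rw [← Real.rpow_mul (by positivity), Real.div_rpow hr0.le ht0.le, div_eq_mul_inv,
        ← Real.rpow_neg ht0.le]
      norm_num
    have f2 : (|t| / |r| ^ 2) ^ (1 / 4 : ℝ) = |t| ^ (1 / 4 : ℝ) * |r| ^ (-(1 / 2) : ℝ) := by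
      rw [Real.div_rpow ht0.le (by positivity), ← Real.rpow_natCast |r| 2,
        ← Real.rpow_mul hr0.le, div_eq_mul_inv, ← Real.rpow_neg hr0.le]
      norm_num
    calc D = D ^ (3 / 4 : ℝ) * D ^ (1 / 4 : ℝ) := by
          rw [← Real.rpow_add_of_nonneg hD0 (by norm_num) (by norm_num)]
          norm_num
      _ ≤ (M * (|r| / |t|) ^ (1 / 2 : ℝ)) ^ (3 / 4 : ℝ) *
          (M * (|t| / |r| ^ 2)) ^ (1 / 4 : ℝ) := by gcongr
      _ = (M ^ (3 / 4 : ℝ) * M ^ (1 / 4 : ℝ)) * ((|t| ^ (-(3 / 8) : ℝ) * |t| ^ (1 / 4 : ℝ)) *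
          (|r| ^ (3 / 8 : ℝ) * |r| ^ (-(1 / 2) : ℝ))) := by
          rw [Real.mul_rpow hM0 (by positivity), Real.mul_rpow hM0 (by positivity), f1, f2]
          ring
      _ = _ := by
          rw [← Real.rpow_add_of_nonneg hM0 (by norm_num) (by norm_num), ← Real.rpow_add ht0,
            ← Real.rpow_add hr0]
          norm_num
          ring
  have hlim := (h₁.sub h₂).norm
  have hbd : ‖u₁ - u₂‖ ≤ Z * (P * (M * |t| ^ (-(1 / 8) : ℝ))) := by
    refine le_of_tendsto hlim (Eventually.of_forall fun R => ?_)
    rw [slabIntegral, slabIntegral, ← integral_sub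
      (integrableOn_slab hφ hb hbε hq₁ t y s R) (integrableOn_slab hφ hb hbε hq₂ t y s R)]
    have := hZ (fun r => (φ r : ℂ) * (sliceIntegral b a q₁ t y r - sliceIntegral b a q₂ t y r))
      (P * (M * |t| ^ (-(1 / 8) : ℝ))) s (by positivity)
      (fun r hr => by rw [hφ.eq_zero r hr, Complex.ofReal_zero, zero_mul])
      (fun r hr => by
        rw [norm_mul, Complex.norm_real, mul_assoc P]
        gcongr
        · exact hP r
        · exact hdiff r hr) R
    refine le_of_eq_of_le ?_ this
    congr 2
    ext r
    ring
  calc |t| ^ (1 / 8 : ℝ) * ‖u₁ - u₂‖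
      ≤ |t| ^ (1 / 8 : ℝ) * (Z * (P * (M * |t| ^ (-(1 / 8) : ℝ)))) := by gcongr
    _ = Z * (P * M) * (|t| ^ (1 / 8 : ℝ) * |t| ^ (-(1 / 8) : ℝ)) := by ring
    _ = Z * (P * M) := by
      rw [← Real.rpow_add ht0]
      norm_num

end PrincipalValue

/-! ### Coordinates `(ξ₁, ξ')`, and a radial mean value estimate -/

/-- The inclusion `ξ' ↦ (0, ξ')`. -/
def lift (n : ℕ) : EuclideanSpace ℝ (Fin n) →L[ℝ] Space n :=
  LinearMap.toContinuousLinearMap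
    { toFun := fun η => WithLp.toLp 2 (Fin.cons 0 η)
      map_add' := fun x y => by
        ext i
        refine Fin.cases ?_ (fun j => ?_) i <;> simp
      map_smul' := fun c x => by
        ext i
        refine Fin.cases ?_ (fun j => ?_) i <;> simp }

@[simp]
theorem lift_zero_apply {n : ℕ} (η : EuclideanSpace ℝ (Fin n)) : lift n η 0 = 0 := rfl

@[simp]
theorem lift_succ_apply {n : ℕ} (η : EuclideanSpace ℝ (Fin n)) (j : Fin n) :
    lift n η j.succ = η j := rfl

@[simp]
theorem e₁_zero_apply (n : ℕ) : e₁ n 0 = 1 := by simp [e₁]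

@[simp]
theorem e₁_succ_apply {n : ℕ} (j : Fin n) : e₁ n j.succ = 0 := by
  simp [e₁]

@[simp]
theorem prime_smul_e₁_add_lift {n : ℕ} (r : ℝ) (η : EuclideanSpace ℝ (Fin n)) :
    prime (r • e₁ n + lift n η) = η := by
  ext j
  simp [prime]

theorem smul_e₁_add_lift_prime {n : ℕ} (ξ : Space n) : ξ 0 • e₁ n + lift n (prime ξ) = ξ := by
  ext i
  refine Fin.cases ?_ (fun j => ?_) i <;> simp [prime]

theorem lift_single {n : ℕ} (j : Fin n) :
    lift n (EuclideanSpace.single j 1) = EuclideanSpace.single j.succ 1 := by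
  ext i
  refine Fin.cases ?_ (fun k => ?_) i
  · simp
  · simp

theorem bilin_apply_eq_sum {m : ℕ}
    (T : EuclideanSpace ℝ (Fin m) →L[ℝ] EuclideanSpace ℝ (Fin m) →L[ℝ] ℝ)
    (x y : EuclideanSpace ℝ (Fin m)) :
    T x y = ∑ i, ∑ j, T (EuclideanSpace.single i 1) (EuclideanSpace.single j 1) * x i * y j := by
  have h : ∀ z : EuclideanSpace ℝ (Fin m), z = ∑ i, z i • EuclideanSpace.single i (1 : ℝ) :=
    fun z => by simpa using ((EuclideanSpace.basisFun (Fin m) ℝ).sum_repr z).symm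
  conv_lhs => rw [h x, h y]
  simp only [map_sum, sum_apply, map_smul, smul_apply,
    smul_eq_mul]
  simp only [Finset.mul_sum]
  rw [Finset.sum_comm]
  refine Finset.sum_congr rfl fun i _ => Finset.sum_congr rfl fun j _ => ?_
  ring

/-- Integrating a bound `‖f'‖ ≤ C ‖x‖ᵏ` on a ball from its centre. -/
theorem norm_le_of_norm_fderiv_le_pow {E F : Type*} [NormedAddCommGroup E] [NormedSpace ℝ E]
    [NormedAddCommGroup F] [NormedSpace ℝ F] {f : E → F} {f' : E → E →L[ℝ] F} {ε C : ℝ} {k : ℕ}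
    (hC : 0 ≤ C) (hf : ∀ x ∈ Metric.ball 0 ε, HasFDerivAt f (f' x) x) (h0 : f 0 = 0)
    (hb : ∀ x ∈ Metric.ball 0 ε, ‖f' x‖ ≤ C * ‖x‖ ^ k) :
    ∀ x ∈ Metric.ball 0 ε, ‖f x‖ ≤ C * ‖x‖ ^ (k + 1) := by
  intro x hx
  have hsub : Metric.closedBall (0 : E) ‖x‖ ⊆ Metric.ball 0 ε :=
    Metric.closedBall_subset_ball (by simpa using hx)
  have := (convex_closedBall (0 : E) ‖x‖).norm_image_sub_le_of_norm_hasFDerivWithin_le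
    (f := f) (C := C * ‖x‖ ^ k) (x := 0) (y := x)
    (fun y hy => (hf y (hsub hy)).hasFDerivWithinAt)
    (fun y hy => (hb y (hsub hy)).trans (by
      have : ‖y‖ ≤ ‖x‖ := by simpa using hy
      gcongr))
    (by simp) (by simp)
  rw [h0, sub_zero, sub_zero] at this
  rw [pow_succ, ← mul_assoc]
  exact this

/-! ### Homogeneity of the sheet and Euler's identities -/

namespace IsSmoothSheet

variable {n k : ℕ} {A : Fin (n + 1) → Hom k} {W : Set (ℝ × Space n)} {N : Set (Space n)}
  {τ : Space n → ℝ}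

theorem e₁_mem (hτ : IsSmoothSheet A W N τ) : e₁ n ∈ N ∧ τ (e₁ n) = 0 := by
  have h : ((0 : ℝ), e₁ n) ∈ conormalVariety n := by
    refine ⟨fun h => ?_, rfl, ?_⟩
    · have := congrArg (fun p : ℝ × Space n => p.2 0) h
      simp at this
    · ext j
      simp [prime]
  have h1 : ((0 : ℝ), e₁ n) ∈ charVariety A ∩ W :=
    ⟨hτ.conormal_subset_char h, hτ.conormal_subset h⟩
  rw [hτ.char_eq_graph] at h1
  exact ⟨h1.1, h1.2.symm⟩

theorem smul_mem_charVariety {σ : ℝ} (hσ : σ ≠ 0) {p : ℝ × Space n} (hp : p ∈ charVariety A) :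
    σ • p ∈ charVariety A := by
  refine ⟨smul_ne_zero hσ hp.1, ?_⟩
  have h : (((σ • p).1 : ℝ) : ℂ) • (1 : Hom k) + symbol A (σ • p).2 =
      (σ : ℂ) • ((p.1 : ℂ) • (1 : Hom k) + symbol A p.2) := by
    simp only [symbol, Prod.smul_fst, Prod.smul_snd, smul_add, Finset.smul_sum, smul_smul,
      smul_eq_mul, PiLp.smul_apply, Complex.ofReal_mul]
  rw [h, Matrix.det_smul, hp.2, mul_zero]

/-- The characteristic variety and `W` are both conic, so `σ • (τ ξ, ξ)` lies on the graph again,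
and a graph has only one point above `σ • ξ`. -/
theorem homogeneous (hτ : IsSmoothSheet A W N τ) {σ : ℝ} (hσ : σ ≠ 0) {ξ : Space n} (hξ : ξ ∈ N) :
    τ (σ • ξ) = σ * τ ξ := by
  have h : (τ ξ, ξ) ∈ charVariety A ∩ W := by
    rw [hτ.char_eq_graph]
    exact ⟨hξ, rfl⟩
  have h1 : σ • (τ ξ, ξ) ∈ charVariety A ∩ W :=
    ⟨smul_mem_charVariety hσ h.1, hτ.isOpenCone_W.smul_mem σ hσ _ h.2⟩
  rw [hτ.char_eq_graph] at h1
  exact h1.2.symm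

end IsSmoothSheet

section Homogeneous

variable {n : ℕ} {N : Set (Space n)} {lam : Space n → ℝ}

/-- Euler's identity: differentiate `lam (σ • ξ) = σ * lam ξ` at `σ = 1`. -/
theorem fderiv_apply_self_of_homogeneous (hd : ∀ ξ ∈ N, ContDiffAt ℝ 4 lam ξ)
    (hh : ∀ σ : ℝ, σ ≠ 0 → ∀ ξ ∈ N, lam (σ • ξ) = σ * lam ξ) {ξ : Space n} (hξ : ξ ∈ N) :
    fderiv ℝ lam ξ ξ = lam ξ := by
  have h1 : HasDerivAt (fun σ : ℝ => σ • ξ) ξ 1 := by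
    simpa using (hasDerivAt_id (1 : ℝ)).smul_const ξ
  have h2 : HasFDerivAt lam (fderiv ℝ lam ξ) ((1 : ℝ) • ξ) := by
    rw [one_smul]
    exact ((hd ξ hξ).differentiableAt (by norm_num)).hasFDerivAt
  have h3 : HasDerivAt (fun σ : ℝ => lam (σ • ξ)) (fderiv ℝ lam ξ ξ) 1 :=
    h2.comp_hasDerivAt 1 h1
  have h4 : HasDerivAt (fun σ : ℝ => lam (σ • ξ)) (lam ξ) 1 := by
    have : HasDerivAt (fun σ : ℝ => σ * lam ξ) (lam ξ) 1 := by
      simpa using (hasDerivAt_id (1 : ℝ)).mul_const (lam ξ)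
    refine this.congr_of_eventuallyEq ?_
    filter_upwards [eventually_ne_nhds (one_ne_zero (α := ℝ))] with σ hσ
    exact hh σ hσ ξ hξ
  exact h3.unique h4

/-- Differentiating Euler's identity along `u` leaves only this term. Thus the radial direction is
in the kernel of the Hessian, which at `e₁ n` is determined by its primed block. -/
theorem snd_fderiv_apply_self_of_homogeneous (hN : IsOpenCone N)
    (hd : ∀ ξ ∈ N, ContDiffAt ℝ 4 lam ξ)
    (hh : ∀ σ : ℝ, σ ≠ 0 → ∀ ξ ∈ N, lam (σ • ξ) = σ * lam ξ) {ξ : Space n} (hξ : ξ ∈ N)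
    (u : Space n) : fderiv ℝ (fderiv ℝ lam) ξ u ξ = 0 := by
  have h1 : HasFDerivAt (fderiv ℝ lam) (fderiv ℝ (fderiv ℝ lam) ξ) ξ :=
    (((hd ξ hξ).fderiv_right (m := 1) (by norm_num)).differentiableAt one_ne_zero).hasFDerivAt
  have h2 := h1.clm_apply (hasFDerivAt_id ξ)
  have h3 : HasFDerivAt lam (fderiv ℝ lam ξ) ξ :=
    ((hd ξ hξ).differentiableAt (by norm_num)).hasFDerivAt
  have h4 : (fun ζ => fderiv ℝ lam ζ (id ζ)) =ᶠ[𝓝 ξ] lam := by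
    filter_upwards [hN.isOpen.mem_nhds hξ] with ζ hζ
    exact fderiv_apply_self_of_homogeneous hd hh hζ
  have h5 := (h3.congr_of_eventuallyEq h4).unique h2
  have h6 := congrArg (fun T : Space n →L[ℝ] ℝ => T u) h5
  simpa using h6

theorem hessian_apply {m : ℕ} {f : EuclideanSpace ℝ (Fin m) → ℝ} {ξ : EuclideanSpace ℝ (Fin m)}
    (hf : ContDiffAt ℝ 4 f ξ) (i j : Fin m) :
    hessian f ξ i j = fderiv ℝ (fderiv ℝ f) ξ (EuclideanSpace.single i 1)
      (EuclideanSpace.single j 1) := by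
  have h1 : HasFDerivAt (fderiv ℝ f) (fderiv ℝ (fderiv ℝ f) ξ) ξ :=
    ((hf.fderiv_right (m := 1) (by norm_num)).differentiableAt one_ne_zero).hasFDerivAt
  have h2 := h1.clm_apply (hasFDerivAt_const (EuclideanSpace.single j (1 : ℝ)) ξ)
  rw [hessian, Matrix.of_apply, h2.fderiv]
  simp

end Homogeneous

/-! ### The phase in the chart `ξ₁ = 1` -/

/-- Second derivative of `ξ' ↦ lam(1, ξ')`. -/
def chartHess {n : ℕ} (lam : Space n → ℝ) (η : EuclideanSpace ℝ (Fin n)) :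
    EuclideanSpace ℝ (Fin n) →L[ℝ] EuclideanSpace ℝ (Fin n) →L[ℝ] ℝ :=
  (fderiv ℝ (fderiv ℝ lam) (e₁ n + lift n η)).bilinearComp (lift n) (lift n)

/-- The deviation of `lam` from its linearization, in the chart `ξ₁ = 1`. -/
def chartPhase {n : ℕ} (lam : Space n → ℝ) (η : EuclideanSpace ℝ (Fin n)) : ℝ :=
  lam (e₁ n + lift n η) - inner ℝ (groupVelocity lam) (e₁ n + lift n η)

theorem inner_groupVelocity {n : ℕ} (lam : Space n → ℝ) (x : Space n) :
    inner ℝ (groupVelocity lam) x = fderiv ℝ lam (e₁ n) x := by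
  rw [groupVelocity, gradient, InnerProductSpace.toDual_symm_apply]

theorem Q_eq_half_chartHess {n : ℕ} {lam : Space n → ℝ} (hd : ContDiffAt ℝ 4 lam (e₁ n))
    (η : EuclideanSpace ℝ (Fin n)) : Q lam η = (1 / 2) * chartHess lam 0 η η := by
  rw [Q, bilin_apply_eq_sum (chartHess lam 0)]
  congr 1
  refine Finset.sum_congr rfl fun i _ => Finset.sum_congr rfl fun j _ => ?_
  rw [hessian_apply hd]
  simp [chartHess, lift_single]

section Chart

variable {n : ℕ} {lam : Space n → ℝ} {ε : ℝ}

theorem hasFDerivAt_e₁_add_lift (η : EuclideanSpace ℝ (Fin n)) :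
    HasFDerivAt (fun η => e₁ n + lift n η) (lift n) η :=
  (lift n).hasFDerivAt.const_add _

/-- The derivative is written as a difference so that its vanishing at `η = 0` is visible. -/
theorem hasFDerivAt_chartPhase {η : EuclideanSpace ℝ (Fin n)}
    (hd : ContDiffAt ℝ 4 lam (e₁ n + lift n η)) :
    HasFDerivAt (chartPhase lam)
      ((fderiv ℝ lam (e₁ n + lift n η) - fderiv ℝ lam (e₁ n)).comp (lift n)) η := by
  have h1 : HasFDerivAt (fun η => lam (e₁ n + lift n η)) _ η :=
    (((hd.differentiableAt (by norm_num)).hasFDerivAt).comp η (hasFDerivAt_e₁_add_lift η))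
  have h2 : HasFDerivAt (fun η => inner ℝ (groupVelocity lam) (e₁ n + lift n η)) _ η :=
    ((fderiv ℝ lam (e₁ n)).hasFDerivAt.comp η (hasFDerivAt_e₁_add_lift η)).congr_of_eventuallyEq
      (Eventually.of_forall fun ζ => inner_groupVelocity lam _)
  rw [ContinuousLinearMap.sub_comp]
  exact h1.sub h2

theorem hasFDerivAt_chartPhase_fderiv {η : EuclideanSpace ℝ (Fin n)}
    (hd : ContDiffAt ℝ 4 lam (e₁ n + lift n η)) :
    HasFDerivAt (fun η => (fderiv ℝ lam (e₁ n + lift n η) - fderiv ℝ lam (e₁ n)).comp (lift n))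
      (chartHess lam η) η := by
  have h1 : HasFDerivAt (fderiv ℝ lam) (fderiv ℝ (fderiv ℝ lam) (e₁ n + lift n η))
      (e₁ n + lift n η) :=
    ((hd.fderiv_right (m := 1) (by norm_num)).differentiableAt one_ne_zero).hasFDerivAt
  have h2 : HasFDerivAt (fun η => fderiv ℝ lam (e₁ n + lift n η)) _ η :=
    h1.comp η (hasFDerivAt_e₁_add_lift η)
  have h3 := (((ContinuousLinearMap.compL ℝ _ _ ℝ).flip (lift n)).hasFDerivAt
    (x := fderiv ℝ lam (e₁ n + lift n η) - fderiv ℝ lam (e₁ n))).comp η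
      (h2.sub_const (fderiv ℝ lam (e₁ n)))
  exact h3

theorem chartHess_symm (hd : ContDiffAt ℝ 4 lam (e₁ n)) (u w : EuclideanSpace ℝ (Fin n)) :
    chartHess lam 0 u w = chartHess lam 0 w u := by
  have : IsSymmSndFDerivAt ℝ lam (e₁ n) := hd.isSymmSndFDerivAt (by simpa using (by norm_num : (2 : WithTop ℕ∞) ≤ 4))
  have := this (lift n u) (lift n w)
  simpa [chartHess] using this

theorem hasFDerivAt_Q (hd : ContDiffAt ℝ 4 lam (e₁ n)) (η : EuclideanSpace ℝ (Fin n)) :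
    HasFDerivAt (Q lam) (chartHess lam 0 η) η := by
  have h1 := ((chartHess lam 0).hasFDerivAt.clm_apply (hasFDerivAt_id η)).const_mul (1 / 2)
  have h2 : Q lam = fun η => (1 / 2) * chartHess lam 0 η (id η) :=
    funext fun η => Q_eq_half_chartHess hd η
  rw [h2]
  refine h1.congr_fderiv ?_
  ext u
  simp [chartHess_symm hd u η]
  ring

/-- The structure of the phase in the chart `ξ₁ = 1`. -/
theorem exists_chart {N : Set (Space n)} (hN : IsOpenCone N)
    (hd : ∀ ξ ∈ N, ContDiffAt ℝ 4 lam ξ)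
    (hh : ∀ σ : ℝ, σ ≠ 0 → ∀ ξ ∈ N, lam (σ • ξ) = σ * lam ξ) (he : e₁ n ∈ N)
    (hrank : (hessian lam (e₁ n)).rank = n ∨ ∀ ξ ∈ N, hessian lam ξ = 0) :
    ∃ ε C : ℝ, 0 < ε ∧ 0 ≤ C ∧ (∀ η ∈ Metric.ball 0 ε, e₁ n + lift n η ∈ N) ∧
      (∀ η ∈ Metric.ball 0 ε, |chartPhase lam η - Q lam η| ≤ C * ‖η‖ ^ 3) ∧
      (∀ η ∈ Metric.ball 0 ε, |chartPhase lam η| ≤ C * ‖η‖ ^ 2) ∧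
      (∀ η ∈ Metric.ball 0 ε, |Q lam η| ≤ C * ‖η‖ ^ 2) ∧
      ((∃ (w : EuclideanSpace ℝ (Fin n)) (c σ : ℝ), w ≠ 0 ∧ 0 < c ∧ |σ| = 1 ∧
        (∀ η ∈ Metric.ball 0 ε, c ≤ σ * chartHess lam η w w) ∧ c ≤ σ * chartHess lam 0 w w) ∨
      ((∀ η ∈ Metric.ball 0 ε, chartPhase lam η = 0) ∧
        ∀ η ∈ Metric.ball 0 ε, Q lam η = 0)) := by
  have hde : ContDiffAt ℝ 4 lam (e₁ n) := hd _ he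
  have hcont : Continuous fun η : EuclideanSpace ℝ (Fin n) => e₁ n + lift n η := by fun_prop
  have h00 : e₁ n + lift n (0 : EuclideanSpace ℝ (Fin n)) = e₁ n := by simp
  have hN' : ∀ᶠ η in 𝓝 (0 : EuclideanSpace ℝ (Fin n)), e₁ n + lift n η ∈ N :=
    hcont.continuousAt.eventually_mem (by rw [h00]; exact hN.isOpen.mem_nhds he)
  -- Euler's identity at `e₁ n`: the linear part takes the value of `lam` there.
  have hchart0 : chartPhase lam 0 = 0 := by
    rw [chartPhase, h00, inner_groupVelocity, fderiv_apply_self_of_homogeneous hd hh he,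
      sub_self]
  have hQ0 : Q lam 0 = 0 := by simp [Q_eq_half_chartHess hde]
  -- Taylor's formula by integrating the Hessian bound twice. The case `C = 0` is used for flat
  -- sheets.
  have taylor : ∀ (ε C : ℝ), 0 ≤ C → (∀ η ∈ Metric.ball 0 ε, e₁ n + lift n η ∈ N) →
      (∀ η ∈ Metric.ball 0 ε, ‖chartHess lam η - chartHess lam 0‖ ≤ C * ‖η‖ ^ 1) →
      ∀ η ∈ Metric.ball 0 ε, |chartPhase lam η - Q lam η| ≤ C * ‖η‖ ^ 3 := by
    intro ε C hC hεN hb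
    have h1 := norm_le_of_norm_fderiv_le_pow hC
      (f := fun η => (fderiv ℝ lam (e₁ n + lift n η) - fderiv ℝ lam (e₁ n)).comp (lift n) -
        chartHess lam 0 η)
      (fun η hη => (hasFDerivAt_chartPhase_fderiv (hd _ (hεN η hη))).sub
        (chartHess lam 0).hasFDerivAt) (by simp) hb
    have h2 := norm_le_of_norm_fderiv_le_pow hC (f := fun η => chartPhase lam η - Q lam η)
      (fun η hη => (hasFDerivAt_chartPhase (hd _ (hεN η hη))).sub (hasFDerivAt_Q hde η))
      (by rw [hchart0, hQ0, sub_zero]) h1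
    exact h2
  have hQb : ∀ η, |Q lam η| ≤ ‖chartHess lam 0‖ * ‖η‖ ^ 2 := fun η => by
    rw [Q_eq_half_chartHess hde, abs_mul, abs_of_pos (by norm_num : (0 : ℝ) < 1 / 2)]
    have h1 := (chartHess lam 0).le_opNorm₂ η η
    rw [Real.norm_eq_abs] at h1
    have h2 : 0 ≤ ‖chartHess lam 0‖ * ‖η‖ * ‖η‖ := by positivity
    calc _ ≤ 1 * (‖chartHess lam 0‖ * ‖η‖ * ‖η‖) := by gcongr; norm_num
      _ = _ := by ring
  have degenerate : ∀ ε, 0 < ε → (∀ η ∈ Metric.ball 0 ε, e₁ n + lift n η ∈ N) →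
      (∀ η ∈ Metric.ball 0 ε, chartPhase lam η = 0) → (∀ η ∈ Metric.ball 0 ε, Q lam η = 0) →
      ∃ ε C : ℝ, 0 < ε ∧ 0 ≤ C ∧ (∀ η ∈ Metric.ball 0 ε, e₁ n + lift n η ∈ N) ∧
      (∀ η ∈ Metric.ball 0 ε, |chartPhase lam η - Q lam η| ≤ C * ‖η‖ ^ 3) ∧
      (∀ η ∈ Metric.ball 0 ε, |chartPhase lam η| ≤ C * ‖η‖ ^ 2) ∧
      (∀ η ∈ Metric.ball 0 ε, |Q lam η| ≤ C * ‖η‖ ^ 2) ∧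
      ((∃ (w : EuclideanSpace ℝ (Fin n)) (c σ : ℝ), w ≠ 0 ∧ 0 < c ∧ |σ| = 1 ∧
        (∀ η ∈ Metric.ball 0 ε, c ≤ σ * chartHess lam η w w) ∧ c ≤ σ * chartHess lam 0 w w) ∨
      ((∀ η ∈ Metric.ball 0 ε, chartPhase lam η = 0) ∧
        ∀ η ∈ Metric.ball 0 ε, Q lam η = 0)) := by
    intro ε hε hεN h1 h2
    refine ⟨ε, 0, hε, le_rfl, hεN, fun η hη => ?_, fun η hη => ?_, fun η hη => ?_, Or.inr ⟨h1, h2⟩⟩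
    · simp [h1 η hη, h2 η hη]
    · simp [h1 η hη]
    · simp [h2 η hη]
  obtain ⟨ε₀, hε₀, hε₀N⟩ := Metric.eventually_nhds_iff_ball.1 hN'
  -- One direction in which the quadratic form is nonzero suffices; full nondegeneracy of the form
  -- is never needed.
  by_cases hnd : ∃ w, chartHess lam 0 w w ≠ 0
  · rcases hrank with hrank | hzero
    swap
    · obtain ⟨w, hw⟩ := hnd
      refine absurd ?_ hw
      rw [chartHess, h00, ContinuousLinearMap.bilinearComp_apply, bilin_apply_eq_sum]
      refine Finset.sum_eq_zero fun i _ => Finset.sum_eq_zero fun j _ => ?_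
      rw [← hessian_apply hde, hzero _ he]
      simp
    obtain ⟨w, hw⟩ := hnd
    have hdiff : DifferentiableAt ℝ (fderiv ℝ (fderiv ℝ lam)) (e₁ n) :=
      (((hde.fderiv_right (m := 3) (by norm_num)).fderiv_right (m := 1)
        (by norm_num)).differentiableAt one_ne_zero)
    have hch : DifferentiableAt ℝ (chartHess lam) 0 := by
      have h1 : DifferentiableAt ℝ (fun η => fderiv ℝ (fderiv ℝ lam) (e₁ n + lift n η)) 0 := by
        rw [← h00] at hdiff
        exact DifferentiableAt.comp (F := Space n) (G := Space n →L[ℝ] Space n →L[ℝ] ℝ)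
          (0 : EuclideanSpace ℝ (Fin n)) hdiff (hasFDerivAt_e₁_add_lift 0).differentiableAt
      exact ((differentiableAt_const ((ContinuousLinearMap.compL ℝ _ _ ℝ).flip (lift n))).clm_comp
        h1).clm_comp (differentiableAt_const (lift n))
    obtain ⟨C, hC⟩ := (DifferentiableAt.isBigO_sub (𝕜 := ℝ)
      (E := EuclideanSpace ℝ (Fin n)) (F := EuclideanSpace ℝ (Fin n) →L[ℝ] EuclideanSpace ℝ (Fin n) →L[ℝ] ℝ) hch).bound
    simp only [sub_zero] at hC
    set a := chartHess lam 0 w w with ha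
    -- With sign `a / |a|` the form equals `|a|` on `w` at the centre, and continuity keeps at least
    -- half of it nearby.
    have hc0 : ∀ᶠ η in 𝓝 0, |a| / 2 ≤ a / |a| * chartHess lam η w w := by
      have h1 : ContinuousAt (fun η => a / |a| * chartHess lam η w w) 0 :=
        continuousAt_const.mul ((hch.continuousAt.clm_apply continuousAt_const).clm_apply
          continuousAt_const)
      have h2 : |a| / 2 < a / |a| * chartHess lam 0 w w := by
        have h3 : 0 < |a| := abs_pos.2 hw
        rw [← ha, div_mul_eq_mul_div, ← abs_mul_abs_self a, mul_div_assoc, div_self h3.ne',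
          mul_one]
        exact half_lt_self h3
      filter_upwards [h1.eventually (lt_mem_nhds h2)] with η hη using hη.le
    obtain ⟨ε, hε, h⟩ := Metric.eventually_nhds_iff_ball.1 (hN'.and (hC.and hc0))
    have hεN : ∀ η ∈ Metric.ball 0 ε, e₁ n + lift n η ∈ N := fun η hη => (h η hη).1
    set C' := |C| with hC'
    have ht := taylor ε C' (abs_nonneg C) hεN fun η hη => by
      rw [pow_one]
      refine (h η hη).2.1.trans ?_
      gcongr
      exact le_abs_self C
    set D := ‖chartHess lam 0‖ with hD
    -- One constant for three bounds: `C'` for the cubic remainder, `C' * ε + D` for `chartPhase`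
    -- (using `‖η‖ ≤ ε`), and `D` for `Q`.
    refine ⟨ε, C' + C' * ε + D, hε, by positivity, hεN, fun η hη => ?_, fun η hη => ?_,
      fun η hη => ?_, Or.inl ⟨w, |a| / 2, a / |a|, ?_, by positivity, ?_, fun η hη => (h η hη).2.2,
        (h 0 (Metric.mem_ball_self hε)).2.2⟩⟩
    · refine (ht η hη).trans ?_
      gcongr
      have : 0 ≤ C' * ε + D := by positivity
      linarith
    · have hη' : ‖η‖ ≤ ε := by
        have : ‖η‖ < ε := by simpa using hη
        exact this.le
      calc |chartPhase lam η| = |(chartPhase lam η - Q lam η) + Q lam η| := by ring_nf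
        _ ≤ C' * ‖η‖ ^ 3 + D * ‖η‖ ^ 2 := (abs_add_le _ _).trans (add_le_add (ht η hη) (hQb η))
        _ = (C' * ‖η‖ + D) * ‖η‖ ^ 2 := by ring
        _ ≤ _ := by
          gcongr
          have : C' * ‖η‖ ≤ C' * ε := by gcongr
          have : 0 ≤ C' := abs_nonneg C
          linarith
    · refine (hQb η).trans ?_
      gcongr
      have : 0 ≤ C' + C' * ε := by positivity
      linarith
    · rintro rfl
      simp [ha] at hw
    · rw [abs_div, abs_abs, div_self (abs_pos.2 hw).ne']
  · push Not at hnd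
    -- Polarization: a symmetric bilinear form with zero diagonal vanishes.
    have hB0 : chartHess lam 0 = 0 := by
      ext u w
      have h1 := hnd (u + w)
      have h2 := chartHess_symm hde u w
      simp only [map_add, add_apply, hnd u, hnd w] at h1
      simp only [zero_apply]
      linarith
    have hQz : ∀ η, Q lam η = 0 := fun η => by
      rw [Q_eq_half_chartHess hde, hB0]
      simp
    rcases hrank with hrank | hzero
    -- With the primed block zero and the radial direction in the kernel, the whole Hessian
    -- vanishes. Its rank `n` is then `0`, and the chart is a single point.
    · have hH : hessian lam (e₁ n) = 0 := by
        have hr : ∀ u, fderiv ℝ (fderiv ℝ lam) (e₁ n) u (EuclideanSpace.single 0 1) = 0 :=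
          snd_fderiv_apply_self_of_homogeneous hN hd hh he
        have hs : IsSymmSndFDerivAt ℝ lam (e₁ n) := hde.isSymmSndFDerivAt (by simpa using (by norm_num : (2 : WithTop ℕ∞) ≤ 4))
        ext i j
        rw [hessian_apply hde, Matrix.zero_apply]
        refine Fin.cases ?_ (fun j => ?_) j
        · exact hr _
        refine Fin.cases ?_ (fun i => ?_) i
        · rw [hs]
          exact hr _
        · rw [← lift_single, ← lift_single]
          have := congrArg (fun T => T (EuclideanSpace.single i 1) (EuclideanSpace.single j 1)) hB0
          simpa [chartHess] using this
      rw [hH, Matrix.rank_zero] at hrank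
      subst hrank
      refine degenerate ε₀ hε₀ hε₀N (fun η _ => ?_) fun η _ => hQz η
      rw [Subsingleton.elim η 0, hchart0]
    · refine degenerate ε₀ hε₀ hε₀N (fun η hη => ?_) fun η _ => hQz η
      have h1 := taylor ε₀ 0 le_rfl hε₀N (fun η hη => by
        have : chartHess lam η = 0 := by
          ext u w
          rw [chartHess, ContinuousLinearMap.bilinearComp_apply, bilin_apply_eq_sum]
          refine Finset.sum_eq_zero fun i _ => Finset.sum_eq_zero fun j _ => ?_
          rw [← hessian_apply (hd _ (hε₀N η hη)), hzero _ (hε₀N η hη)]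
          simp
        refine le_trans ?_ (by positivity : (0 : ℝ) ≤ 0 * ‖η‖ ^ 1)
        exact norm_le_zero_iff.2 (sub_eq_zero.2 (this.trans hB0.symm))) η hη
      rw [hQz, sub_zero, zero_mul] at h1
      exact abs_nonpos_iff.1 h1

end Chart

/-! ### Slice decay for the exact and the paraxial phase -/

section Decay

variable {n : ℕ} {lam : Space n → ℝ} {ε : ℝ} {b : EuclideanSpace ℝ (Fin n) → ℂ}
  {a : 𝓢(EuclideanSpace ℝ (Fin n), ℂ)}

theorem contDiffOn_chartPhase
    (hd : ∀ η ∈ Metric.ball 0 ε, ContDiffAt ℝ 4 lam (e₁ n + lift n η)) :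
    ContDiffOn ℝ 2 (chartPhase lam) (Metric.ball 0 ε) := by
  intro η hη
  have h1 : ContDiff ℝ 2 fun η : EuclideanSpace ℝ (Fin n) => e₁ n + lift n η :=
    contDiff_const.add (lift n).contDiff
  have h2 : ContDiffAt ℝ 2 lam (e₁ n + lift n η) := (hd η hη).of_le (by norm_num)
  have h3 : ContDiffAt ℝ 2 (fun η => lam (e₁ n + lift n η)) η :=
    ContDiffAt.comp η h2 h1.contDiffAt
  have h4 : ContDiffAt ℝ 2 (fun η => inner ℝ (groupVelocity lam) (e₁ n + lift n η)) η :=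
    contDiffAt_const.inner ℝ h1.contDiffAt
  exact (h3.sub h4).contDiffWithinAt

theorem contDiff_Q (hd : ContDiffAt ℝ 4 lam (e₁ n)) : ContDiff ℝ 2 (Q lam) := by
  have h2 : Q lam = fun η => (1 / 2) * chartHess lam 0 η η :=
    funext fun η => Q_eq_half_chartHess hd η
  rw [h2]
  exact contDiff_const.mul ((chartHess lam 0).contDiff.clm_apply contDiff_id)

theorem hasSliceDecay_chartPhase (hb : ContDiff ℝ 1 b) (hbε : tsupport b ⊆ Metric.ball 0 ε)
    (hd : ∀ η ∈ Metric.ball 0 ε, ContDiffAt ℝ 4 lam (e₁ n + lift n η))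
    {w : EuclideanSpace ℝ (Fin n)} (hw : w ≠ 0) {c σ : ℝ} (hc : 0 < c) (hσ : |σ| = 1)
    (h : ∀ η ∈ Metric.ball 0 ε, c ≤ σ * chartHess lam η w w) :
    HasSliceDecay b a (chartPhase lam) := by
  refine exists_norm_sliceIntegral_le_sqrt hb hbε (contDiffOn_chartPhase hd) hw hc hσ
    fun η hη => ?_
  have h1 : (fun ζ => fderiv ℝ (chartPhase lam) ζ w) =ᶠ[𝓝 η] fun ζ =>
      (fderiv ℝ lam (e₁ n + lift n ζ) - fderiv ℝ lam (e₁ n)).comp (lift n) w := by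
    filter_upwards [Metric.isOpen_ball.mem_nhds hη] with ζ hζ
    rw [(hasFDerivAt_chartPhase (hd ζ hζ)).fderiv]
  have h2 := ((hasFDerivAt_chartPhase_fderiv (hd η hη)).clm_apply
    (hasFDerivAt_const w η)).congr_of_eventuallyEq h1
  rw [h2.fderiv]
  simpa using h η hη

theorem hasSliceDecay_Q (hb : ContDiff ℝ 1 b) (hbε : tsupport b ⊆ Metric.ball 0 ε)
    (hd : ContDiffAt ℝ 4 lam (e₁ n))
    {w : EuclideanSpace ℝ (Fin n)} (hw : w ≠ 0) {c σ : ℝ} (hc : 0 < c) (hσ : |σ| = 1)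
    (h : c ≤ σ * chartHess lam 0 w w) : HasSliceDecay b a (Q lam) := by
  refine exists_norm_sliceIntegral_le_sqrt hb hbε (contDiff_Q hd).contDiffOn hw hc hσ
    fun η _ => ?_
  have h1 : (fun ζ => fderiv ℝ (Q lam) ζ w) = fun ζ => chartHess lam 0 ζ w :=
    funext fun ζ => by rw [(hasFDerivAt_Q hd ζ).fderiv]
  have h2 := (chartHess lam 0).hasFDerivAt (x := η) |>.clm_apply (hasFDerivAt_const w η)
  rw [h1, h2.fderiv]
  simpa using h

end Decay

/-! ### Reduction to one dimension -/

section Fubini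

variable {n : ℕ}

theorem measurePreserving_smul_e₁_add_lift (n : ℕ) :
    MeasurableEmbedding (fun p : ℝ × EuclideanSpace ℝ (Fin n) => p.1 • e₁ n + lift n p.2) ∧
    MeasurePreserving (fun p : ℝ × EuclideanSpace ℝ (Fin n) => p.1 • e₁ n + lift n p.2)
      (volume.prod volume) volume := by
  set E₁ : ℝ × EuclideanSpace ℝ (Fin n) ≃ᵐ ℝ × (Fin n → ℝ) :=
    (MeasurableEquiv.refl ℝ).prodCongr (MeasurableEquiv.toLp 2 (Fin n → ℝ)).symm
  set E₂ : ℝ × (Fin n → ℝ) ≃ᵐ (Fin (n + 1) → ℝ) :=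
    (MeasurableEquiv.piFinSuccAbove (fun _ => ℝ) 0).symm
  set E₃ : (Fin (n + 1) → ℝ) ≃ᵐ Space n := MeasurableEquiv.toLp 2 (Fin (n + 1) → ℝ)
  have he : (fun p : ℝ × EuclideanSpace ℝ (Fin n) => p.1 • e₁ n + lift n p.2) =
      (E₁.trans (E₂.trans E₃)) := by
    ext p i
    refine Fin.cases ?_ (fun j => ?_) i
    · simp [E₁, E₂, E₃]
      rfl
    · simp [E₁, E₂, E₃]
      rfl
  rw [he]
  refine ⟨MeasurableEquiv.measurableEmbedding _, ?_⟩
  have h1 : MeasurePreserving E₁ (volume.prod volume) (volume.prod volume) :=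
    (MeasurePreserving.id volume).prod (PiLp.volume_preserving_ofLp (Fin n))
  have h2 : MeasurePreserving E₂ (volume.prod volume) volume :=
    (volume_preserving_piFinSuccAbove (fun _ => ℝ) 0).symm
  have h3 : MeasurePreserving E₃ volume volume := PiLp.volume_preserving_toLp (Fin (n + 1))
  exact (h3.comp h2).comp h1

variable {b : EuclideanSpace ℝ (Fin n) → ℂ} {β : Space n → ℂ}
  {a : 𝓢(EuclideanSpace ℝ (Fin n), ℂ)} {φ : ℝ → ℝ} {ε : ℝ} {q : EuclideanSpace ℝ (Fin n) → ℝ}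
  {Λ : Space n → ℝ} {v : Space n}

/-- The integrand in the coordinates `(r, ξ')`. -/
theorem integrand_smul_e₁_add_lift
    (hβ : ∀ σ : ℝ, σ ≠ 0 → ∀ ξ, β (σ • ξ) = β ξ)
    (hbε : tsupport (fun η => β (e₁ n + lift n η)) ⊆ Metric.ball 0 ε)
    (hΛ : ∀ r : ℝ, r ≠ 0 → ∀ η ∈ Metric.ball 0 ε,
      Λ (r • (e₁ n + lift n η)) = r * (inner ℝ v (e₁ n + lift n η) + q η))
    (t : ℝ) (x : Space n) (r : ℝ) (η : EuclideanSpace ℝ (Fin n)) :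
    integrand β φ a Λ t x (r • e₁ n + lift n η) =
      ((φ r : ℂ) * (Complex.exp (Complex.I * ((x + t • v) 0 * r : ℝ)) / r)) *
        sliceIntegrand (fun η => β (e₁ n + lift n η)) a q t (prime (x + t • v)) r η := by
  have h0 : (r • e₁ n + lift n η) 0 = r := by simp
  rcases eq_or_ne r 0 with rfl | hr
  -- At `r = 0` both sides contain a division by zero, hence vanish.
  · rw [integrand, h0]
    simp
  have hξ : r • e₁ n + lift n η = r • (e₁ n + lift n (r⁻¹ • η)) := by
    rw [smul_add, map_smul, smul_smul, mul_inv_cancel₀ hr, one_smul]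
  rw [integrand, h0, prime_smul_e₁_add_lift, sliceIntegrand]
  have hβr : β (r • e₁ n + lift n η) = β (e₁ n + lift n (r⁻¹ • η)) := by
    rw [hξ, hβ r hr]
  by_cases h : r⁻¹ • η ∈ tsupport fun η => β (e₁ n + lift n η)
  · have hΛr := hΛ r hr _ (hbε h)
    rw [← hξ] at hΛr
    -- The velocity `v` merges with `x`: the linear part of the phase depends only on `x + t • v`.
    have hphase : inner ℝ x (r • e₁ n + lift n η) + t * Λ (r • e₁ n + lift n η) =
        (x + t • v) 0 * r + (inner ℝ (prime (x + t • v)) η + t * (r * q (r⁻¹ • η))) := by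
      have h1 : inner ℝ (x + t • v) (r • e₁ n + lift n η) =
          (x + t • v) 0 * r + inner ℝ (prime (x + t • v)) η := by
        simp only [PiLp.inner_apply, Fin.sum_univ_succ, prime]
        simp
        ring
      have h2 : r * inner ℝ v (e₁ n + lift n (r⁻¹ • η)) = inner ℝ v (r • e₁ n + lift n η) := by
        rw [hξ, inner_smul_right]
      rw [hΛr, mul_add r, h2, ← add_assoc ((x + t • v) 0 * r), ← h1, inner_add_left,
        real_inner_smul_left]
      ring
    rw [hphase, hβr, Complex.ofReal_add, mul_add, Complex.exp_add]
    ring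
  · have := image_eq_zero_of_notMem_tsupport h
    rw [hβr, this]
    simp

/-- Fubini on each slab `|ξ₁| ≤ R`. Absolute convergence holds because `φ(r) / r` is bounded, `r`
ranges over a bounded interval and `a` is integrable. -/
theorem hasPVIntegral_of_tendsto_slabIntegral (hφ : IsCutoff φ)
    (hβ : ∀ σ : ℝ, σ ≠ 0 → ∀ ξ, β (σ • ξ) = β ξ)
    (hb : ContDiff ℝ 1 fun η => β (e₁ n + lift n η))
    (hbε : tsupport (fun η => β (e₁ n + lift n η)) ⊆ Metric.ball 0 ε)
    (hq : ContinuousOn q (Metric.ball 0 ε))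
    (hΛ : ∀ r : ℝ, r ≠ 0 → ∀ η ∈ Metric.ball 0 ε,
      Λ (r • (e₁ n + lift n η)) = r * (inner ℝ v (e₁ n + lift n η) + q η))
    {t : ℝ} {x : Space n} {u : ℂ}
    (hu : Tendsto (fun R => slabIntegral (fun η => β (e₁ n + lift n η)) φ a q t
      (prime (x + t • v)) ((x + t • v) 0) R) atTop (𝓝 u)) :
    HasPVIntegral (integrand β φ a Λ t x) u := by
  set b : EuclideanSpace ℝ (Fin n) → ℂ := fun η => β (e₁ n + lift n η) with hbdef
  set y := prime (x + t • v) with hy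
  set s := (x + t • v) 0 with hs
  set c : ℝ → ℂ := fun r => (φ r : ℂ) * (Complex.exp (Complex.I * (s * r : ℝ)) / r) with hc
  obtain ⟨hemb, hmp⟩ := measurePreserving_smul_e₁_add_lift n
  set Φ := fun p : ℝ × EuclideanSpace ℝ (Fin n) => p.1 • e₁ n + lift n p.2 with hΦ
  have hcomp : ∀ p : ℝ × EuclideanSpace ℝ (Fin n), integrand β φ a Λ t x (Φ p) =
      c p.1 * sliceIntegrand b a q t y p.1 p.2 := fun p =>
    integrand_smul_e₁_add_lift hβ hbε hΛ t x p.1 p.2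
  have hpre : ∀ R : ℝ, Φ ⁻¹' {ξ : Space n | |ξ 0| ≤ R} = {r : ℝ | |r| ≤ R} ×ˢ Set.univ := by
    intro R
    ext p
    have : (Φ p) 0 = p.1 := by simp [hΦ]
    change |(Φ p) 0| ≤ R ↔ (|p.1| ≤ R ∧ True)
    rw [this, and_true]
  obtain ⟨P, hP1, hP⟩ := hφ.exists_bound
  have hP0 : 0 ≤ P := zero_le_one.trans hP1
  obtain ⟨K, hK⟩ :=
    (hasCompactSupport_of_tsupport_subset_ball hbε).exists_bound_of_continuous hb.continuous
  have hK0 : 0 ≤ K := (norm_nonneg _).trans (hK 0)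
  have hcm : Measurable c := by
    refine (Complex.measurable_ofReal.comp hφ.smooth.continuous.measurable).mul
      (Measurable.div ?_ (by fun_prop))
    exact Continuous.measurable (by fun_prop)
  have hcb : ∀ r, ‖c r‖ ≤ P := fun r => by
    rcases le_or_gt |r| 1 with hr | hr
    · simpa [hc, hφ.eq_zero r hr] using hP0
    · simp only [hc]
      rw [norm_mul, norm_div, mul_comm Complex.I, Complex.norm_exp_ofReal_mul_I,
        Complex.norm_real, Complex.norm_real, Real.norm_eq_abs, Real.norm_eq_abs]
      have h1 : 1 / |r| ≤ 1 := by
        rw [div_le_one (one_pos.trans hr)]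
        exact hr.le
      calc |φ r| * (1 / |r|) ≤ P * 1 := by
            gcongr
            exact hP r
        _ = P := mul_one P
  have hint : ∀ R : ℝ, IntegrableOn (fun p : ℝ × EuclideanSpace ℝ (Fin n) =>
      c p.1 * sliceIntegrand b a q t y p.1 p.2) ({r : ℝ | |r| ≤ R} ×ˢ Set.univ)
      (volume.prod volume) := by
    intro R
    rw [IntegrableOn, ← Measure.prod_restrict, Measure.restrict_univ]
    have hfin : IsFiniteMeasure (volume.restrict {r : ℝ | |r| ≤ R}) := by
      rw [setOf_abs_le_eq_Icc]
      infer_instance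
    have h1 : Integrable (fun p : ℝ × EuclideanSpace ℝ (Fin n) => (P * K) * ‖a p.2‖)
        ((volume.restrict {r : ℝ | |r| ≤ R}).prod volume) :=
      (integrable_const (P * K)).mul_prod (a.integrable (μ := volume)).norm
    refine h1.mono' ?_ (Eventually.of_forall fun p => ?_)
    · exact ((hcm.comp measurable_fst).mul
        (measurable_sliceIntegrand hb.continuous hbε hq t y)).aestronglyMeasurable
    · rw [norm_mul, norm_sliceIntegrand, mul_assoc]
      gcongr
      · exact hcb _
      · exact hK _
  have hcomp' : integrand β φ a Λ t x ∘ Φ = fun p => c p.1 * sliceIntegrand b a q t y p.1 p.2 :=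
    funext hcomp
  refine ⟨fun R => ?_, hu.congr fun R => ?_⟩
  · rw [← hmp.integrableOn_comp_preimage hemb, hpre, hcomp']
    exact hint R
  · rw [← hmp.setIntegral_preimage_emb hemb, hpre]
    simp_rw [hcomp]
    rw [setIntegral_prod _ (hint R), slabIntegral]
    congr 1
    ext r
    rw [Measure.restrict_univ]
    simp only [hc]
    rw [integral_const_mul, ← sliceIntegral]
    ring

end Fubini

/-! ### Conic cutoffs near the `ξ₁` axis -/

section Cutoff

variable {n : ℕ} {β : Space n → ℂ} {ε : ℝ}

/-- The cone of aperture `ε` around the `ξ₁` axis. -/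
def axisCone (n : ℕ) (ε : ℝ) : Set (Space n) := {ξ | ‖prime ξ‖ < ε * |ξ 0|}

theorem continuous_prime : Continuous (prime : Space n → EuclideanSpace ℝ (Fin n)) := by
  unfold prime
  fun_prop

theorem prime_smul (σ : ℝ) (ξ : Space n) : prime (σ • ξ) = σ • prime ξ := by
  ext j
  simp [prime]

theorem isOpenCone_axisCone (n : ℕ) (ε : ℝ) : IsOpenCone (axisCone n ε) where
  isOpen := isOpen_lt continuous_prime.norm (by fun_prop)
  zero_notMem := by
    intro h
    have h' : ‖prime (0 : Space n)‖ < ε * |(0 : Space n) 0| := h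
    simp only [PiLp.zero_apply, abs_zero, mul_zero] at h'
    exact absurd h' (not_lt.2 (norm_nonneg _))
  smul_mem := by
    intro σ hσ ξ h
    have h' : ‖prime ξ‖ < ε * |ξ 0| := h
    change ‖prime (σ • ξ)‖ < ε * |(σ • ξ) 0|
    rw [prime_smul, norm_smul, PiLp.smul_apply, smul_eq_mul, abs_mul, Real.norm_eq_abs,
      mul_left_comm]
    exact mul_lt_mul_of_pos_left h' (abs_pos.2 hσ)

/-- The hyperplane `ξ₁ = 1` avoids the origin, the only point where `β` may fail to be smooth. -/
theorem contDiff_chart_of_isConicCutoff {G : Set (Space n)} (hβ : IsConicCutoff G β) :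
    ContDiff ℝ 1 fun η => β (e₁ n + lift n η) := by
  have h1 : ContDiff ℝ 1 fun η : EuclideanSpace ℝ (Fin n) => e₁ n + lift n η :=
    contDiff_const.add (lift n).contDiff
  refine contDiff_iff_contDiffAt.2 fun η => ?_
  have hne : e₁ n + lift n η ∈ ({0}ᶜ : Set (Space n)) := by
    intro h
    have := congrArg (fun ξ : Space n => ξ 0) (Set.mem_singleton_iff.1 h)
    simp at this
  have h2 : ContDiffAt ℝ 1 β (e₁ n + lift n η) :=
    (hβ.smooth.contDiffAt (isOpen_compl_singleton.mem_nhds hne)).of_le (by simp)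
  exact ContDiffAt.comp η h2 h1.contDiffAt

theorem tsupport_chart_subset_ball (hβ : IsConicCutoff (axisCone n ε) β) :
    tsupport (fun η => β (e₁ n + lift n η)) ⊆ Metric.ball 0 ε := by
  intro η hη
  have hc : Continuous fun η : EuclideanSpace ℝ (Fin n) => e₁ n + lift n η := by fun_prop
  have h1 : e₁ n + lift n η ∈ tsupport β := tsupport_comp_subset_preimage β hc hη
  have hne : e₁ n + lift n η ∉ ({0} : Set (Space n)) := by
    intro h
    have := congrArg (fun ξ : Space n => ξ 0) (Set.mem_singleton_iff.1 h)
    simp at this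
  have h2 : ‖prime (e₁ n + lift n η)‖ < ε * |(e₁ n + lift n η) 0| := hβ.support_subset ⟨h1, hne⟩
  have h3 := prime_smul_e₁_add_lift 1 η
  rw [one_smul] at h3
  rw [h3] at h2
  simpa using h2

theorem axisCone_subset {N : Set (Space n)} (hN : IsOpenCone N)
    (h : ∀ η ∈ Metric.ball 0 ε, e₁ n + lift n η ∈ N) : axisCone n ε ⊆ N := by
  intro ξ hξ
  have hξ' : ‖prime ξ‖ < ε * |ξ 0| := hξ
  have h0 : ξ 0 ≠ 0 := by
    intro h0
    rw [h0, abs_zero, mul_zero] at hξ'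
    exact absurd hξ' (not_lt.2 (norm_nonneg _))
  have h1 : e₁ n + lift n ((ξ 0)⁻¹ • prime ξ) ∈ N := by
    apply h
    rw [mem_ball_zero_iff, norm_smul, norm_inv, Real.norm_eq_abs, inv_mul_lt_iff₀ (abs_pos.2 h0),
      mul_comm]
    exact hξ'
  have h2 := hN.smul_mem (ξ 0) h0 _ h1
  rwa [smul_add, map_smul, smul_smul, mul_inv_cancel₀ h0, one_smul, smul_e₁_add_lift_prime] at h2

end Cutoff

theorem Q_smul {n : ℕ} {lam : Space n → ℝ} (r : ℝ) (η : EuclideanSpace ℝ (Fin n)) :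
    Q lam (r • η) = r ^ 2 * Q lam η := by
  simp only [Q, PiLp.smul_apply, smul_eq_mul, Finset.mul_sum]
  refine Finset.sum_congr rfl fun i _ => Finset.sum_congr rfl fun j _ => ?_
  ring

/-- `Q` is quadratic, so `Q(r η) / r = r Q(η)`; this puts the paraxial phase in the form required by
`hasPVIntegral_of_tendsto_slabIntegral`. -/
theorem paraxial_smul_chart {n : ℕ} {lam : Space n → ℝ} {r : ℝ} (hr : r ≠ 0)
    (η : EuclideanSpace ℝ (Fin n)) :
    paraxial lam (r • (e₁ n + lift n η)) =
      r * (inner ℝ (groupVelocity lam) (e₁ n + lift n η) + Q lam η) := by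
  have h3 := prime_smul_e₁_add_lift 1 η
  rw [one_smul] at h3
  have h4 : (r • (e₁ n + lift n η)) 0 = r := by simp
  rw [paraxial, prime_smul, h3, h4, Q_smul, inner_smul_right]
  field_simp

end PlanarJump

end

theorem mainTheorem6 (n k : ℕ)
    (A : Fin (n + 1) → PlanarJump.Hom k) (hA : PlanarJump.IsStronglyHyperbolic A)
    (W : Set (ℝ × PlanarJump.Space n)) (N : Set (PlanarJump.Space n))
    (τ lam : PlanarJump.Space n → ℝ)
    (hτ : PlanarJump.IsSmoothSheet A W N τ) (hlam : ∀ ξ, lam ξ = -τ ξ)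
    (hrank : (PlanarJump.hessian lam (PlanarJump.e₁ n)).rank = n ∨
      ∀ ξ ∈ N, PlanarJump.hessian lam ξ = 0)
    (t₀ : ℝ) (x₀ ξ₀ : PlanarJump.Space n) (h₀ : (t₀, x₀) ≠ 0)
    (hstat : PlanarJump.IsStationary lam t₀ x₀ ξ₀) :
    ∃ (G : Set (PlanarJump.Space n)) (M : Set (ℝ × PlanarJump.Space n)) (μ : ℝ),
      PlanarJump.IsOpenCone G ∧ ξ₀ ∈ G ∧ G ⊆ N ∧
      PlanarJump.IsOpenCone M ∧ (t₀, x₀) ∈ M ∧ 0 < μ ∧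
      ∀ (φ : ℝ → ℝ) (a : 𝓢(EuclideanSpace ℝ (Fin n), ℂ)) (β : PlanarJump.Space n → ℂ),
        PlanarJump.IsCutoff φ → PlanarJump.IsConicCutoff G β →
        ∃ u uPar : ℝ × PlanarJump.Space n → ℂ,
          (∀ p ∈ M, PlanarJump.HasPVIntegral
            (PlanarJump.integrand β φ a lam p.1 p.2) (u p)) ∧
          (∀ p ∈ M, PlanarJump.HasPVIntegral
            (PlanarJump.integrand β φ a (PlanarJump.paraxial lam) p.1 p.2) (uPar p)) ∧
          (∃ C : ℝ, ∀ p ∈ M, ‖u p‖ ≤ C) ∧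
          (∃ C : ℝ, ∀ p ∈ M, |p.1| ^ μ * ‖u p - uPar p‖ ≤ C) := by
  open PlanarJump in
  have hlam' : lam = fun ξ => -τ ξ := funext hlam
  have hd : ∀ ξ ∈ N, ContDiffAt ℝ 4 lam ξ := fun ξ hξ => by
    rw [hlam']
    exact (hτ.analytic ξ hξ).contDiffAt.neg
  have hh : ∀ σ : ℝ, σ ≠ 0 → ∀ ξ ∈ N, lam (σ • ξ) = σ * lam ξ := fun σ hσ ξ hξ => by
    rw [hlam, hlam, hτ.homogeneous hσ hξ, mul_neg]
  have hN := hτ.isOpenCone_N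
  have he := hτ.e₁_mem.1
  have hde := hd _ he
  obtain ⟨ε, C, hε, hC, hεN, hq3, hq2, hQ2, hcases⟩ := exists_chart hN hd hh he hrank
  have hdε : ∀ η ∈ Metric.ball 0 ε, ContDiffAt ℝ 4 lam (e₁ n + lift n η) :=
    fun η hη => hd _ (hεN η hη)
  -- The bounds are uniform in `t`, `y` and `s`, so `M` can be the whole complement of the origin;
  -- `1 / 8` is the exponent from the interpolation.
  refine ⟨axisCone n ε, {0}ᶜ, 1 / 8, isOpenCone_axisCone n ε, ?_, axisCone_subset hN hεN,
    ⟨isOpen_compl_singleton, by simp, fun σ hσ p hp => smul_ne_zero hσ hp⟩, h₀, by norm_num, ?_⟩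
  · change ‖prime ξ₀‖ < ε * |ξ₀ 0|
    have h1 := smul_e₁_add_lift_prime ξ₀
    rw [hstat.prime_eq_zero, map_zero, add_zero] at h1
    rw [hstat.prime_eq_zero, norm_zero]
    refine mul_pos hε (abs_pos.2 fun h => hstat.ne_zero ?_)
    rw [← h1, h, zero_smul]
  intro φ a β hφ hβ
  have hb := contDiff_chart_of_isConicCutoff hβ
  have hbε := tsupport_chart_subset_ball hβ
  have hqc : ContinuousOn (chartPhase lam) (Metric.ball 0 ε) :=
    (contDiffOn_chartPhase hdε).continuousOn
  have hQc : ContinuousOn (Q lam) (Metric.ball 0 ε) := (contDiff_Q hde).continuous.continuousOn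
  have hΛ : ∀ r : ℝ, r ≠ 0 → ∀ η ∈ Metric.ball 0 ε, lam (r • (e₁ n + lift n η)) =
      r * (inner ℝ (groupVelocity lam) (e₁ n + lift n η) + chartPhase lam η) :=
    fun r hr η hη => by
      rw [hh r hr _ (hεN η hη), chartPhase]
      ring
  have hΛ' : ∀ r : ℝ, r ≠ 0 → ∀ η ∈ Metric.ball 0 ε, paraxial lam (r • (e₁ n + lift n η)) =
      r * (inner ℝ (groupVelocity lam) (e₁ n + lift n η) + Q lam η) :=
    fun r hr η _ => paraxial_smul_chart hr η
  set b : EuclideanSpace ℝ (Fin n) → ℂ := fun η => β (e₁ n + lift n η) with hbdef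
  have hdec : HasSliceDecay b a (chartPhase lam) ∧ HasSliceDecay b a (Q lam) ∨
      ((∀ η ∈ Metric.ball 0 ε, chartPhase lam η = 0) ∧ ∀ η ∈ Metric.ball 0 ε, Q lam η = 0) := by
    rcases hcases with ⟨w, c, σ, hw, hc, hσ, h1, h2⟩ | h
    · exact Or.inl ⟨hasSliceDecay_chartPhase hb hbε hdε hw hc hσ h1,
        hasSliceDecay_Q hb hbε hde hw hc hσ h2⟩
    · exact Or.inr h
  obtain ⟨B, hB⟩ := exists_tendsto_slabIntegral (a := a) hφ hb hbε hqc hC hq2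
    (hdec.imp And.left And.left)
  obtain ⟨B', hB'⟩ := exists_tendsto_slabIntegral (a := a) hφ hb hbε hQc hC hQ2
    (hdec.imp And.right And.right)
  choose U hU hUt using hB
  choose U' hU' hUt' using hB'
  set v := groupVelocity lam with hv
  refine ⟨fun p => U p.1 (prime (p.2 + p.1 • v)) ((p.2 + p.1 • v) 0),
    fun p => U' p.1 (prime (p.2 + p.1 • v)) ((p.2 + p.1 • v) 0),
    fun p _ => hasPVIntegral_of_tendsto_slabIntegral hφ hβ.homogeneous hb hbε hqc hΛ (hUt _ _ _),
    fun p _ => hasPVIntegral_of_tendsto_slabIntegral hφ hβ.homogeneous hb hbε hQc hΛ' (hUt' _ _ _),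
    ⟨B, fun p _ => hU _ _ _⟩, ?_⟩
  rcases hdec with ⟨h1, h2⟩ | ⟨h1, h2⟩
  · obtain ⟨D, hD⟩ := exists_rpow_mul_norm_sub_le hφ hb hbε hqc hQc hC hq3 h1 h2
    exact ⟨D, fun p _ => hD _ _ _ _ _ (hUt _ _ _) (hUt' _ _ _)⟩
  -- In the flat case both phase functions vanish on the ball, so the two slab integrals agree and
  -- so do their limits.
  · refine ⟨0, fun p _ => ?_⟩
    have heq : ∀ t y s, U t y s = U' t y s := fun t y s => by
      refine tendsto_nhds_unique (hUt t y s) ((hUt' t y s).congr fun R => ?_)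
      have : ∀ r, sliceIntegral b a (Q lam) t y r = sliceIntegral b a (chartPhase lam) t y r := by
        intro r
        unfold sliceIntegral
        congr 1
        ext η
        exact sliceIntegrand_congr hbε (fun η hη => (h2 η hη).trans (h1 η hη).symm) t y r η
      simp only [slabIntegral, this]
    simp only [heq, sub_self, norm_zero, mul_zero, le_refl]
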